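/- Let $X$ be a translation surface: a compact connected surface with a finite non-empty set $\Sigma$ of conical points of angles $2\pi(k+1)$, $k\ge 0$ ($k=0$ is a marked point), and an atlas of $X\setminus\Sigma$ with values in $\mathbb R^2$ whose coordinate changes are locally translations. Let $\mathrm{dist}$ be the flat distance and $\mathrm{Leb}$ the area measure on $X$, and for $\theta\in\mathbb R$ let $\phi_\theta$ be the unit speed linear flow on $X$ in direction $e_\theta=(\sin\theta,\cos\theta)$, which is defined for all times outside a null set. For points $p,p'$ and $r>0$ put $$R(\phi_\theta,p,p',r)=\inf\{t>r \mid \mathrm{dist}(\phi_\theta^t(p),p')<r\}\in(0,\infty],$$ and let the limsup hitting time be $$w^{\sup}_{hit}(\phi_\theta,p,p')=\limsup_{r\to0^+}\frac{\log R(\phi_\theta,p,p',r)}{-\log r}\in[-\infty,\infty].$$ A cylinder $C_\sigma$ is a maximal connected open subset of $X\setminus\Sigma$ foliated by closed geodesics parallel to a closed geodesic $\sigma$, with the same length and orientation. If $v\in\mathbb R^2$ is the planar development (holonomy) of $\sigma$, put $$\mathrm{Re}(\sigma,\theta)=\langle v,(\cos\theta,-\sin\theta)\rangle,\qquad \mathrm{Im}(\sigma,\theta)=\langle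 v,(\sin\theta,\cos\theta)\rangle .$$ For $a>0$ let $w^{cyl}(X,\theta)\in[1,\infty]$ be the supremum, taken in $[1,\infty]$ (so that it is $1$ if there is no such $w$), of those real $w\ge1$ for which there are infinitely many cylinders $C_\sigma$ with $\mathrm{Area}(C_\sigma)\ge a$, $|\mathrm{Im}(\sigma,\theta)|\ge1$ and $$|\mathrm{Re}(\sigma,\theta)|<\frac{1}{|\mathrm{Im}(\sigma,\theta)|^{w}} .$$ Proposition. If $\theta$ is an ergodic direction on $X$, that is, if $\mathrm{Leb}$ is ergodic for $\phi_\theta$, then for every $a>0$ and for $\mathrm{Leb}\times\mathrm{Leb}$-almost every $(p,p')\in X\times X$, $$w^{\sup}_{hit}(\phi_\theta,p,p')\ \ge\ w^{cyl}(X,\theta).$$ -/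

import Mathlib

open Filter Topology MeasureTheory
open scoped ENNReal

/-- A translation structure on a topological space `X` (in the theorem `X` is compact, connected
and Hausdorff): a finite non-empty set `sing` of conical points, and an atlas of the complement
of `sing` with values in the plane `ℝ² = ℂ` whose coordinate changes are locally translations.
Around a conical point there is a topological coordinate `z`, vanishing there, such that the charts
are locally of the form `z ^ (k + 1) + const`, which means that the total angle is `2 π (k + 1)`.
The value `k = 0` (a marked point of angle `2 π`) is allowed. -/
structure TranslationSurface (X : Type*) [TopologicalSpace X] where
  sing : Set X
  sing_finite : sing.Finite
  sing_nonempty : sing.Nonempty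
  charts : Set (OpenPartialHomeomorph X ℂ)
  disjoint_sing : ∀ e ∈ charts, Disjoint e.source sing
  exists_chart : ∀ p ∉ sing, ∃ e ∈ charts, p ∈ e.source
  translation : ∀ e ∈ charts, ∀ e' ∈ charts, ∀ p ∈ e.source ∩ e'.source,
    ∀ᶠ q in 𝓝 p, e' q - e' p = e q - e p
  conical : ∀ s ∈ sing, ∃ (k : ℕ) (z : OpenPartialHomeomorph X ℂ), s ∈ z.source ∧ z s = 0 ∧
    ∀ p ∈ z.source, p ≠ s → ∃ e ∈ charts, p ∈ e.source ∧
      ∀ᶠ q in 𝓝 p, e q - e p = z q ^ (k + 1) - z p ^ (k + 1)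

namespace TranslationSurface

variable {X : Type*} [TopologicalSpace X]

/-- Near the time `t`, the curve `γ` avoids the conical points and is, in a chart, a straight line
run with constant velocity `v`. -/
def HasVelocityAt (S : TranslationSurface X) (γ : ℝ → X) (v : ℂ) (t : ℝ) : Prop :=
  ∃ e ∈ S.charts, γ t ∈ e.source ∧
    ∀ᶠ s in 𝓝 t, γ s ∈ e.source ∧ e (γ s) = e (γ t) + ((s - t : ℝ) : ℂ) * v

/-- There is a straight segment from `p` to `q` with planar development `v`. Its interior contains
no conical point; its endpoints may be conical. -/
def IsSegment (S : TranslationSurface X) (p q : X) (v : ℂ) : Prop :=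
  ∃ γ : ℝ → X, γ 0 = p ∧ γ 1 = q ∧ ContinuousOn γ (Set.Icc 0 1) ∧
    ∀ t ∈ Set.Ioo (0 : ℝ) 1, S.HasVelocityAt γ v t

/-- The distance of the flat metric: the infimum of the lengths of the broken lines
from `p` to `q`. -/
noncomputable def flatDist (S : TranslationSurface X) (p q : X) : ℝ≥0∞ :=
  ⨅ (n : ℕ) (x : ℕ → X) (v : ℕ → ℂ) (_ : x 0 = p ∧ x n = q ∧
      ∀ i < n, S.IsSegment (x i) (x (i + 1)) (v i)),
    ENNReal.ofReal (∑ i ∈ Finset.range n, ‖v i‖)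

/-- The Lebesgue measure (area) of the surface: the smallest measure that is, in each chart, at
least the Lebesgue measure of the plane. Since coordinate changes preserve the planar measure, it
is the planar measure in each chart, and the conical points have measure zero. -/
noncomputable def area [MeasurableSpace X] (S : TranslationSurface X) : Measure X :=
  ⨆ e ∈ S.charts, ((volume : Measure ℂ).restrict e.target).map e.symm

/-- The unit vector `(sin θ, cos θ)` in direction `θ`; the vertical is `θ = 0`. -/
noncomputable def dir (θ : ℝ) : ℂ := ⟨Real.sin θ, Real.cos θ⟩

/-- The component of a planar vector orthogonal to the direction `θ`. -/
noncomputable def reComp (v : ℂ) (θ : ℝ) : ℝ := v.re * Real.cos θ - v.im * Real.sin θ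

/-- The component of a planar vector along the direction `θ`. -/
noncomputable def imComp (v : ℂ) (θ : ℝ) : ℝ := v.re * Real.sin θ + v.im * Real.cos θ

/-- `γ` is the bi-infinite orbit of `p` under the unit speed linear flow in direction `θ`. -/
def IsOrbit (S : TranslationSurface X) (θ : ℝ) (p : X) (γ : ℝ → X) : Prop :=
  γ 0 = p ∧ ∀ t : ℝ, S.HasVelocityAt γ (dir θ) t

open Classical in
/-- The linear flow in direction `θ`. On the (null) set of points that lie on a singular leaf, where
the flow is not defined for all times, it is given the value `p` by convention. -/
noncomputable def flow (S : TranslationSurface X) (θ : ℝ) (t : ℝ) (p : X) : X :=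
  if h : ∃ γ : ℝ → X, S.IsOrbit θ p γ then h.choose t else p

/-- `θ` is an ergodic direction: the Lebesgue measure is ergodic for the linear flow. -/
def IsErgodicDirection [MeasurableSpace X] (S : TranslationSurface X) (θ : ℝ) : Prop :=
  ∀ A : Set X, MeasurableSet A → (∀ t : ℝ, S.flow θ t ⁻¹' A = A) → S.area A = 0 ∨ S.area Aᶜ = 0

/-- The hitting time of `p` to the ball of radius `r` around `p'`, which is
`inf {t > r | dist (φ^t p) p' < r}`, with value `∞` if there is no such time. -/
noncomputable def hittingTime (S : TranslationSurface X) (θ : ℝ) (p p' : X) (r : ℝ) : ℝ≥0∞ :=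
  ⨅ (t : ℝ) (_ : r < t ∧ S.flatDist (S.flow θ t p) p' < ENNReal.ofReal r), ENNReal.ofReal t

/-- The limsup hitting time exponent, `limsup_{r → 0⁺} log R(p, p', r) / (- log r)`. -/
noncomputable def limsupHitting (S : TranslationSurface X) (θ : ℝ) (p p' : X) : EReal :=
  limsup (fun r : ℝ => ENNReal.log (S.hittingTime θ p p' r) / ((-Real.log r : ℝ) : EReal)) (𝓝[>] 0)

/-- `γ` is a closed geodesic with planar development `v`, run once in unit time; its length
is `‖v‖`. -/
def IsClosedGeodesic (S : TranslationSurface X) (v : ℂ) (γ : ℝ → X) : Prop :=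
  v ≠ 0 ∧ (∀ t : ℝ, S.HasVelocityAt γ v t) ∧ (∀ t : ℝ, γ (t + 1) = γ t) ∧
    Set.InjOn γ (Set.Ico 0 1)

/-- `C` is open, connected and foliated by closed geodesics with the same planar
development `v`, that is parallel with the same length and orientation. -/
def IsFoliated (S : TranslationSurface X) (v : ℂ) (C : Set X) : Prop :=
  IsOpen C ∧ IsConnected C ∧
    ∀ p ∈ C, ∃ γ : ℝ → X, S.IsClosedGeodesic v γ ∧ γ 0 = p ∧ ∀ t : ℝ, γ t ∈ C

/-- `C` is a cylinder around a closed geodesic with planar development `v`. -/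
def IsCylinder (S : TranslationSurface X) (v : ℂ) (C : Set X) : Prop :=
  Maximal (S.IsFoliated v) C

/-- There are infinitely many cylinders `C` of area at least `a`, around closed geodesics `σ`, with
`|Re (σ, θ)| < 1 / |Im (σ, θ)| ^ w`. The normalization `1 ≤ |Im (σ, θ)|` keeps only
cylinders that approximate the direction `θ` and not its orthogonal. -/
def CylApproximable [MeasurableSpace X] (S : TranslationSurface X) (a θ w : ℝ) : Prop :=
  {C : Set X | ENNReal.ofReal a ≤ S.area C ∧ ∃ v : ℂ, S.IsCylinder v C ∧
    1 ≤ |imComp v θ| ∧ |reComp v θ| < 1 / |imComp v θ| ^ w}.Infinite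

/-- The diophantine type `w^{cyl}(X, θ)`, for the lower bound `a` on the areas: the supremum, taken
in `[1, ∞]`, of those `w ≥ 1` with infinitely many solutions. -/
noncomputable def wCyl [MeasurableSpace X] (S : TranslationSurface X) (a θ : ℝ) : EReal :=
  max 1 (⨆ (w : ℝ) (_ : 1 ≤ w ∧ S.CylApproximable a θ w), (w : EReal))

end TranslationSurface

/-!
The inequality has two halves, since `wCyl` is at least `1` by definition.

*Exponent at least one* (`ae_le_limsupHitting_of_lt_one`). Around a point `p'` with a flat disc of
radius `d`, an orbit that comes `r`-close to `p'`, with `4 * r < d`, is within `2 * r` of `p'` at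
a time that is a multiple of `r`. Hence the points `p'` that are hit before the time `r ^ (-c)`
have area of order `r ^ (1 - c)`, which is summable along `r = 2 ^ (-n)` for `c < 1`, and the
Borel-Cantelli lemma applies on the product.

*Cylinders* (`CylApproximable.ae_le_limsupHitting`). A cylinder with development `v` is the image
of a strip under a flat map with period one (`IsFoliated.exists_isStripMap`). In this coordinate
the flow is a translation which leaves the closed geodesics at a speed proportional to
`reComp v θ`. So for `p` in the cylinder at relative depth `η`, up to a time of order
`η * ‖v‖ ^ 2 / |reComp v θ|`, the orbit is confined to a strip of area of order `η * ‖v‖ ^ 2` and hits no ball of radius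
`η * ‖v‖ / 2` around a point off this strip (`IsStripMap.mem_nearPairs_of_flatDist_lt`). With
`η * ‖v‖ ^ 2 = 2 ^ (-n) * a / 4` for the `n`-th cylinder of a sequence with rapidly increasing
circumferences, the areas of the strips are summable, so almost every `p'` is eventually off them,
while the hitting time is at least `r ^ (-c)`. This needs `p` to lie deep in infinitely many of
the cylinders. The set of such `p` is invariant, because the drift in a fixed time becomes
negligible, and it has positive area, because the cylinders have area at least `a` and the total
area is finite; by ergodicity it has full area.

That the circumferences tend to infinity is `finite_setOf_isCylinder`: infinitely many cylinders
of bounded circumference would have two members with close developments and a common core point,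
and then be equal.

Everything rests on the uniqueness of continuation for maps with a given development
(`eqOn_of_developsAt`), which holds because coordinate changes are translations and `X` is
Hausdorff.
-/

namespace TranslationSurface

variable {X : Type*} [TopologicalSpace X]

/-! ### Maps with a given development -/

/-- The map `Φ` into the surface has, near `x`, the development `g`: in a chart, `Φ` and `g` are
equal up to an additive constant. For `g s = s * v` on `ℝ` these are the curves with velocity `v`,
for `g u = u * v` on `ℂ` the inverses of charts up to scaling and rotation, and for
`g u = u ^ (k + 1)` the coordinates around a conical point. -/
def DevelopsAt {P : Type*} [TopologicalSpace P] (S : TranslationSurface X) (g : P → ℂ)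
    (Φ : P → X) (x : P) : Prop :=
  ∃ e ∈ S.charts, Φ x ∈ e.source ∧
    ∀ᶠ y in 𝓝 x, Φ y ∈ e.source ∧ e (Φ y) = e (Φ x) + (g y - g x)

section Develops

variable {P Q : Type*} [TopologicalSpace P] [TopologicalSpace Q] {S : TranslationSurface X}
  {g : P → ℂ} {Φ Ψ : P → X} {x : P}

theorem hasVelocityAt_iff {γ : ℝ → X} {v : ℂ} {t : ℝ} :
    S.HasVelocityAt γ v t ↔ S.DevelopsAt (fun s : ℝ => (s : ℂ) * v) γ t := by
  unfold HasVelocityAt DevelopsAt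
  simp only [Complex.ofReal_sub, sub_mul]

theorem DevelopsAt.continuousAt (h : S.DevelopsAt g Φ x) (hg : ContinuousAt g x) :
    ContinuousAt Φ x := by
  obtain ⟨e, -, hx, h⟩ := h
  have h1 : ContinuousAt (fun y => e.symm (e (Φ x) + (g y - g x))) x := by
    refine ContinuousAt.comp (g := e.symm) ?_ (by fun_prop)
    simpa using e.symm.continuousAt (x := e (Φ x)) (e.map_source hx)
  refine h1.congr ?_
  filter_upwards [h] with y hy
  rw [← hy.2, e.left_inv hy.1]

theorem DevelopsAt.comp {f : Q → P} {s : Q} (h : S.DevelopsAt g Φ (f s))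
    (hf : ContinuousAt f s) : S.DevelopsAt (g ∘ f) (Φ ∘ f) s := by
  obtain ⟨e, he, hx, h⟩ := h
  exact ⟨e, he, hx, hf.eventually h⟩

theorem DevelopsAt.congr_dev {g' : P → ℂ} (h : S.DevelopsAt g Φ x)
    (hg : ∀ y, g' y - g' x = g y - g x) : S.DevelopsAt g' Φ x := by
  simpa only [DevelopsAt, hg] using h

theorem DevelopsAt.congr (h : S.DevelopsAt g Φ x) (hΦ : Ψ =ᶠ[𝓝 x] Φ) :
    S.DevelopsAt g Ψ x := by
  obtain ⟨e, he, hx, h⟩ := h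
  refine ⟨e, he, hΦ.self_of_nhds ▸ hx, ?_⟩
  filter_upwards [h, hΦ] with y hy hy'
  rw [hy', hΦ.self_of_nhds]
  exact hy

theorem DevelopsAt.eventually (h : S.DevelopsAt g Φ x) :
    ∀ᶠ y in 𝓝 x, S.DevelopsAt g Φ y := by
  obtain ⟨e, he, hx, h⟩ := h
  filter_upwards [h.eventually_nhds] with y hy
  refine ⟨e, he, hy.self_of_nhds.1, ?_⟩
  filter_upwards [hy] with y' hy'
  refine ⟨hy'.1, ?_⟩
  rw [hy'.2, hy.self_of_nhds.2]
  ring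

theorem DevelopsAt.eventuallyEq (h : S.DevelopsAt g Φ x) (h' : S.DevelopsAt g Ψ x)
    (hg : ContinuousAt g x) (hx : Φ x = Ψ x) : Φ =ᶠ[𝓝 x] Ψ := by
  have hc := h'.continuousAt hg
  obtain ⟨e, he, hxe, h⟩ := h
  obtain ⟨e', he', hxe', h'⟩ := h'
  have htr := hc.eventually (S.translation e he e' he' (Ψ x) ⟨hx ▸ hxe, hxe'⟩)
  have hs := hc.eventually (e.open_source.mem_nhds (hx ▸ hxe))
  filter_upwards [h, h', htr, hs] with y hy hy' ht hys
  apply e.injOn hy.1 hys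
  rw [hy.2, hx]
  rw [hy'.2] at ht
  linear_combination ht

/-- Maps with the same development are equal on a preconnected set as soon as they are equal at
one of its points. -/
theorem eqOn_of_developsAt [T2Space X] {K : Set P} (hK : IsPreconnected K)
    (hg : Continuous g) (hΦ : ∀ y ∈ K, S.DevelopsAt g Φ y) (hΨ : ∀ y ∈ K, S.DevelopsAt g Ψ y)
    (hx : x ∈ K) (hxe : Φ x = Ψ x) : Set.EqOn Φ Ψ K := by
  have hU : IsOpen {y | Φ =ᶠ[𝓝 y] Ψ} := isOpen_setOfPred_eventually_nhds
  have hV : IsOpen {y | ∀ᶠ z in 𝓝 y, Φ z ≠ Ψ z} := isOpen_setOfPred_eventually_nhds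
  have hsub := hK.subset_left_of_subset_union hU hV ?_ ?_
    ⟨x, hx, (hΦ x hx).eventuallyEq (hΨ x hx) hg.continuousAt hxe⟩
  · intro y hy
    exact (hsub hy : Φ =ᶠ[𝓝 y] Ψ).self_of_nhds
  · rw [Set.disjoint_left]
    intro y hy hy'
    exact (hy' : ∀ᶠ z in 𝓝 y, Φ z ≠ Ψ z).self_of_nhds (hy : Φ =ᶠ[𝓝 y] Ψ).self_of_nhds
  · intro y hy
    by_cases hye : Φ y = Ψ y
    · exact Or.inl ((hΦ y hy).eventuallyEq (hΨ y hy) hg.continuousAt hye)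
    · exact Or.inr (((hΦ y hy).continuousAt hg.continuousAt).ne_iff_eventually_ne
        ((hΨ y hy).continuousAt hg.continuousAt) |>.1 hye)

end Develops

/-! ### Flat maps, flat discs and flat tubes -/

section Flat

variable {S : TranslationSurface X} {v : ℂ} {Φ Ψ : ℂ → X} {u : ℂ}

/-- `Φ` is, near `u`, the inverse of a chart composed with `u ↦ u * v` and a translation. -/
def FlatAt (S : TranslationSurface X) (v : ℂ) (Φ : ℂ → X) (u : ℂ) : Prop :=
  S.DevelopsAt (fun u => u * v) Φ u

theorem FlatAt.continuousAt (h : S.FlatAt v Φ u) : ContinuousAt Φ u :=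
  DevelopsAt.continuousAt h (by fun_prop)

theorem FlatAt.comp_add {c : ℂ} (h : S.FlatAt v Φ (c + u)) :
    S.FlatAt v (fun y => Φ (c + y)) u := by
  have := DevelopsAt.comp (f := fun y => c + y) (s := u) h (by fun_prop)
  exact this.congr_dev fun y => by simp only [Function.comp]; ring

theorem FlatAt.comp_mul {c : ℂ} (h : S.FlatAt v Φ (u * c)) :
    S.FlatAt (c * v) (fun y => Φ (y * c)) u := by
  have := DevelopsAt.comp (f := fun y => y * c) (s := u) h (by fun_prop)
  exact this.congr_dev fun y => by simp only [Function.comp]; ring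

/-- Straight lines in the source of a flat map are mapped to straight lines. -/
theorem FlatAt.hasVelocityAt {c d : ℂ} {t : ℝ} (h : S.FlatAt v Φ (c + t * d)) :
    S.HasVelocityAt (fun s : ℝ => Φ (c + s * d)) (d * v) t := by
  rw [hasVelocityAt_iff]
  have := DevelopsAt.comp (f := fun s : ℝ => c + s * d) (s := t) h (by fun_prop)
  exact this.congr_dev fun y => by simp only [Function.comp]; ring

theorem FlatAt.map_nhds (hv : v ≠ 0) (h : S.FlatAt v Φ u) : map Φ (𝓝 u) = 𝓝 (Φ u) := by
  obtain ⟨e, -, hx, h⟩ := h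
  have h1 : Φ =ᶠ[𝓝 u] fun y => e.symm (e (Φ u) + (y * v - u * v)) := by
    filter_upwards [h] with y hy
    rw [← hy.2, e.left_inv hy.1]
  rw [Filter.map_congr h1]
  have h2 : map (fun y => e (Φ u) + (y * v - u * v)) (𝓝 u) = 𝓝 (e (Φ u)) := by
    have h3 := ((Homeomorph.mulRight₀ v hv).trans
      (Homeomorph.addLeft (e (Φ u) - u * v))).map_nhds_eq u
    convert h3 using 2
    · ext y; simp; ring
    · simp
  have h4 : (fun y => e.symm (e (Φ u) + (y * v - u * v)))
      = e.symm ∘ (fun y => e (Φ u) + (y * v - u * v)) := rfl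
  rw [h4, ← Filter.map_map, h2, e.symm.map_nhds_eq (e.map_source hx), e.left_inv hx]

theorem isOpen_image_of_flatAt (hv : v ≠ 0) {D : Set ℂ} (hD : IsOpen D)
    (h : ∀ u ∈ D, S.FlatAt v Φ u) : IsOpen (Φ '' D) := by
  rw [isOpen_iff_mem_nhds]
  rintro _ ⟨u, hu, rfl⟩
  rw [← (h u hu).map_nhds hv]
  exact image_mem_map (hD.mem_nhds hu)

theorem FlatAt.eventually_ne (hv : v ≠ 0) (h : S.FlatAt v Φ u) :
    ∀ᶠ y in 𝓝 u, Φ y = Φ u → y = u := by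
  obtain ⟨e, -, hx, h⟩ := h
  filter_upwards [h] with y hy hyu
  have h2 := hy.2
  rw [hyu] at h2
  have : (y - u) * v = 0 := by linear_combination -h2
  rcases mul_eq_zero.1 this with h | h
  · exact sub_eq_zero.1 h
  · exact absurd h hv

theorem eqOn_of_flatAt [T2Space X] {D : Set ℂ} (hD : IsPreconnected D)
    (hΦ : ∀ y ∈ D, S.FlatAt v Φ y) (hΨ : ∀ y ∈ D, S.FlatAt v Ψ y)
    (hu : u ∈ D) (hue : Φ u = Ψ u) : Set.EqOn Φ Ψ D :=
  eqOn_of_developsAt hD (by fun_prop) hΦ hΨ hu hue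

theorem eqOn_of_hasVelocityAt [T2Space X] {K : Set ℝ} (hK : IsPreconnected K) {γ γ' : ℝ → X}
    (hγ : ∀ t ∈ K, S.HasVelocityAt γ v t) (hγ' : ∀ t ∈ K, S.HasVelocityAt γ' v t) {t : ℝ}
    (ht : t ∈ K) (hte : γ t = γ' t) : Set.EqOn γ γ' K :=
  eqOn_of_developsAt hK (by fun_prop) (fun t ht => hasVelocityAt_iff.1 (hγ t ht))
    (fun t ht => hasVelocityAt_iff.1 (hγ' t ht)) ht hte

/-- There is a flat disc in `C` around `p`. Its radius `ε` is measured in the coordinate in which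
the vector `v` is the unit, so it is `ε * ‖v‖` in the flat metric. The disc may be immersed. -/
def HasFlatBall (S : TranslationSurface X) (v : ℂ) (C : Set X) (ε : ℝ) (p : X) : Prop :=
  ∃ Φ : ℂ → X, Φ 0 = p ∧ ∀ u ∈ Metric.ball (0 : ℂ) ε, S.FlatAt v Φ u ∧ Φ u ∈ C

theorem HasFlatBall.mono {C : Set X} {ε ε' : ℝ} {p : X} (h : S.HasFlatBall v C ε p)
    (hε : ε' ≤ ε) : S.HasFlatBall v C ε' p := by
  obtain ⟨Φ, h0, h⟩ := h
  exact ⟨Φ, h0, fun u hu => h u (Metric.ball_subset_ball hε hu)⟩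

theorem exists_hasFlatBall (v : ℂ) {C : Set X} {p : X} (hC : C ∈ 𝓝 p)
    {e : OpenPartialHomeomorph X ℂ} (he : e ∈ S.charts) (hp : p ∈ e.source) : ∃ ε > 0, S.HasFlatBall v C ε p := by
  have hc : ContinuousAt (fun u : ℂ => e p + u * v) 0 := by fun_prop
  have hlim : Tendsto (fun u : ℂ => e p + u * v) (𝓝 0) (𝓝 (e p)) := by
    simpa [ContinuousAt] using hc
  have h1 := hlim.eventually (e.open_target.mem_nhds (e.map_source hp))
  have hs : Tendsto e.symm (𝓝 (e p)) (𝓝 p) := by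
    simpa [ContinuousAt, e.left_inv hp] using e.symm.continuousAt (x := e p) (e.map_source hp)
  have h2 := (hs.comp hlim).eventually hC
  obtain ⟨ε, hε, hb⟩ := Metric.eventually_nhds_iff_ball.1 (h1.and h2)
  refine ⟨ε, hε, fun u => e.symm (e p + u * v), by simp [e.left_inv hp],
    fun u hu => ⟨?_, (hb u hu).2⟩⟩
  refine ⟨e, he, e.map_target (hb u hu).1, ?_⟩
  filter_upwards [Metric.isOpen_ball.mem_nhds hu] with y hy
  refine ⟨e.map_target (hb y hy).1, ?_⟩
  rw [e.right_inv (hb u hu).1, e.right_inv (hb y hy).1]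
  ring

/-- The radius of flat discs along a curve is locally bounded below. -/
theorem exists_hasFlatBall_nhds [T2Space X] {C : Set X} (hC : IsOpen C) {γ : ℝ → X} {t : ℝ}
    (hγ : S.HasVelocityAt γ v t) (ht : γ t ∈ C) :
    ∃ ε > 0, ∀ᶠ s in 𝓝 t, S.HasFlatBall v C ε (γ s) := by
  obtain ⟨e, he, hte, -⟩ := id hγ
  obtain ⟨ε, hε, Φ, h0, hΦ⟩ := exists_hasFlatBall v (hC.mem_nhds ht) he hte
  refine ⟨ε / 2, by positivity, ?_⟩
  have hΦ0 := (hΦ 0 (Metric.mem_ball_self hε)).1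
  have hd : S.DevelopsAt (fun s : ℝ => (s : ℂ) * v) (fun s : ℝ => Φ ((-t : ℂ) + s * 1)) t := by
    rw [← hasVelocityAt_iff]
    have := FlatAt.hasVelocityAt (S := S) (v := v) (Φ := Φ) (c := -t) (d := 1) (t := t)
      (by simpa using hΦ0)
    simpa using this
  have heq := (hasVelocityAt_iff.1 hγ).eventuallyEq hd (by fun_prop) (by simp [h0])
  filter_upwards [heq, Metric.ball_mem_nhds t (half_pos hε)] with s hs hst
  refine ⟨fun u => Φ ((-t + s) + u), by simp [hs], fun u hu => ?_⟩
  have hmem : (-t + s : ℂ) + u ∈ Metric.ball (0 : ℂ) ε := by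
    rw [Metric.mem_ball, dist_zero_right] at hu ⊢
    rw [Metric.mem_ball, Real.dist_eq] at hst
    have : ‖(-t + s : ℂ)‖ = |s - t| := by
      rw [← Real.norm_eq_abs, ← Complex.norm_real]; congr 1; push_cast; ring
    calc _ ≤ ‖(-t + s : ℂ)‖ + ‖u‖ := norm_add_le _ _
      _ < ε := by rw [this]; linarith
  exact ⟨(hΦ _ hmem).1.comp_add, (hΦ _ hmem).2⟩

theorem exists_forall_hasFlatBall [T2Space X] {C : Set X} (hC : IsOpen C) {γ : ℝ → X} {K : Set ℝ}
    (hK : IsCompact K) (hγ : ∀ t ∈ K, S.HasVelocityAt γ v t) (hKC : ∀ t ∈ K, γ t ∈ C) :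
    ∃ ε > 0, ∀ t ∈ K, S.HasFlatBall v C ε (γ t) := by
  refine hK.induction_on (p := fun s => ∃ ε > 0, ∀ t ∈ s, S.HasFlatBall v C ε (γ t))
    ⟨1, one_pos, by simp⟩ ?_ ?_ ?_
  · rintro s s' hs ⟨ε, hε, h⟩
    exact ⟨ε, hε, fun t ht => h t (hs ht)⟩
  · rintro s s' ⟨ε, hε, h⟩ ⟨ε', hε', h'⟩
    refine ⟨min ε ε', lt_min hε hε', ?_⟩
    rintro t (ht | ht)
    · exact (h t ht).mono (min_le_left _ _)
    · exact (h' t ht).mono (min_le_right _ _)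
  · intro t ht
    obtain ⟨ε, hε, h⟩ := exists_hasFlatBall_nhds hC (hγ t ht) (hKC t ht)
    exact ⟨_, mem_nhdsWithin_of_mem_nhds h, ε, hε, fun s hs => hs⟩

/-- A straight curve with flat discs of a uniform radius around its points has a flat tube
around it. The map `π` retracts the plane onto the parameters of the curve. -/
theorem exists_flat_tube [T2Space X] {C : Set X} {γ : ℝ → X} {K : Set ℝ} (hK : K.OrdConnected)
    (hγ : ∀ t ∈ K, S.HasVelocityAt γ v t) {ε : ℝ} 
    (hb : ∀ t ∈ K, S.HasFlatBall v C ε (γ t)) {π : ℂ → ℝ} (hπ : Continuous π)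
    (hπK : ∀ u, π u ∈ K) :
    ∃ Φ : ℂ → X, (∀ u, ‖u - π u‖ < ε → S.FlatAt v Φ u ∧ Φ u ∈ C) ∧
      ∀ t ∈ K, π t = t → Φ t = γ t := by
  have : Nonempty X := ⟨γ 0⟩
  choose! Ψ hΨ0 hΨ using hb
  have hopen : IsOpen {u : ℂ | ‖u - π u‖ < ε} :=
    isOpen_lt (by fun_prop) continuous_const
  have hfl : ∀ t ∈ K, ∀ u : ℂ, ‖u - t‖ < ε → S.FlatAt v (fun y => Ψ t ((-t : ℂ) + y)) u := by
    intro t ht u hu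
    apply FlatAt.comp_add
    refine (hΨ t ht _ ?_).1
    rw [mem_ball_zero_iff]
    rwa [neg_add_eq_sub]
  refine ⟨fun u => Ψ (π u) ((-(π u) : ℂ) + u), fun u hu => ⟨?_, ?_⟩, fun t ht hpt => ?_⟩
  · refine DevelopsAt.congr (Φ := fun y => Ψ (π u) ((-(π u) : ℂ) + y))
      (hfl _ (hπK u) u hu) ?_
    have hε : 0 < ε := (norm_nonneg _).trans_lt hu
    have h1 : ∀ᶠ y : ℂ in 𝓝 u, ‖y - π u‖ < ε :=
      (isOpen_lt (by fun_prop) continuous_const : IsOpen {y : ℂ | ‖y - π u‖ < ε}).mem_nhds hu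
    have h2 : ∀ᶠ y in 𝓝 u, ‖y - π y‖ < ε := hopen.mem_nhds hu
    have h3 : ∀ᶠ y in 𝓝 u, |π y - π u| < ε := by
      have := hπ.continuousAt (x := u)
      exact this.eventually (Metric.ball_mem_nhds (π u) hε)
    filter_upwards [h1, h2, h3] with y hy1 hy2 hy3
    have hpu := hπK u
    have hpy := hπK y
    have hnorm : ‖((π y : ℂ) - π u)‖ < ε := by
      rw [← Complex.ofReal_sub, Complex.norm_real]; exact hy3
    -- both maps are equal at the point of the curve with parameter `π y`
    have key : Ψ (π u) ((-(π u) : ℂ) + π y) = γ (π y) := by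
      have hseg : Set.uIcc (π u) (π y) ⊆ K := hK.uIcc_subset hpu hpy
      refine eqOn_of_hasVelocityAt (S := S) (v := v) (K := Set.uIcc (π u) (π y))
        (γ := fun s : ℝ => Ψ (π u) ((-(π u) : ℂ) + s)) (γ' := γ) (t := π u)
        isPreconnected_uIcc ?_ (fun t ht => hγ t (hseg ht)) Set.left_mem_uIcc
        (by simp [hΨ0 _ hpu]) Set.right_mem_uIcc
      intro t ht
      have hmem : ‖(t : ℂ) - π u‖ < ε := by
        rw [← Complex.ofReal_sub, Complex.norm_real]
        exact lt_of_le_of_lt (Set.abs_sub_left_of_mem_uIcc ht) hy3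
      have := FlatAt.hasVelocityAt (S := S) (v := v) (Φ := Ψ (π u)) (c := -(π u)) (d := 1) (t := t)
        (hΨ _ hpu _ (by rw [mem_ball_zero_iff, mul_one, neg_add_eq_sub]; exact hmem)).1
      simpa using this
    refine eqOn_of_flatAt (S := S) (v := v)
      (D := Metric.ball (π y : ℂ) ε ∩ Metric.ball (π u : ℂ) ε) (u := π y)
      (((convex_ball _ _).inter (convex_ball _ _)).isPreconnected)
      (Φ := fun z => Ψ (π y) ((-(π y) : ℂ) + z)) (Ψ := fun z => Ψ (π u) ((-(π u) : ℂ) + z))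
      (fun z hz => hfl _ hpy z ?_) (fun z hz => hfl _ hpu z ?_)
      ⟨Metric.mem_ball_self hε, ?_⟩ ?_ ⟨?_, ?_⟩
    · exact mem_ball_iff_norm.1 hz.1
    · exact mem_ball_iff_norm.1 hz.2
    · rw [mem_ball_iff_norm]; exact hnorm
    · simp only [neg_add_cancel]; rw [hΨ0 _ hpy, key]
    · rw [mem_ball_iff_norm]; exact hy2
    · rw [mem_ball_iff_norm]; exact hy1
  · refine (hΨ _ (hπK u) _ ?_).2
    rw [mem_ball_zero_iff, neg_add_eq_sub]; exact hu
  · simp only [hpt, neg_add_cancel]; exact hΨ0 t ht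

end Flat

/-! ### The flat distance in a flat disc -/

section Dist

variable {S : TranslationSurface X} {v : ℂ} {Φ : ℂ → X} {u : ℂ}

/-- A segment that starts in the image of a flat map is the image of the segment with the same
development, as long as the latter remains where the map is flat. -/
theorem eq_of_isSegment [T2Space X] (hv : v ≠ 0) {d : ℂ} {q : X}
    (hΦ : ∀ t ∈ Set.Icc (0 : ℝ) 1, S.FlatAt v Φ (u + t * d))
    (h : S.IsSegment (Φ u) q (d * v)) : q = Φ (u + d) := by
  obtain ⟨γ, h0, h1, hc, hvel⟩ := h
  have hu : S.FlatAt v Φ u := by simpa using hΦ 0 (by simp)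
  obtain ⟨e, -, hpe, hev⟩ := id hu
  obtain ⟨r, hr, hball⟩ := Metric.eventually_nhds_iff_ball.1 (hev.and hu.eventually)
  set ε := r / 2 with hε
  have hε0 : 0 < ε := by positivity
  have hIoo : Set.Ioo (0 : ℝ) 1 ∈ 𝓝[>] (0 : ℝ) := Ioo_mem_nhdsGT one_pos
  have hlim0 : Tendsto γ (𝓝[>] 0) (𝓝 (Φ u)) := by
    have := hc 0 (by simp)
    rw [ContinuousWithinAt, h0] at this
    exact this.mono_left (nhdsWithin_le_of_mem
      (mem_of_superset hIoo Set.Ioo_subset_Icc_self))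
  have e1 : ∀ᶠ t in 𝓝[>] (0 : ℝ), γ t ∈ e.source := hlim0.eventually (e.open_source.mem_nhds hpe)
  have e2 : ∀ᶠ t in 𝓝[>] (0 : ℝ), ‖(e (γ t) - e (Φ u)) / v‖ < ε := by
    have : Tendsto (fun t => ‖(e (γ t) - e (Φ u)) / v‖) (𝓝[>] 0)
        (𝓝 ‖(e (Φ u) - e (Φ u)) / v‖) :=
      ((((e.continuousAt hpe).tendsto.comp hlim0).sub_const _).div_const _).norm
    refine this.eventually_lt_const (by simpa using hε0)
  have e3 : ∀ᶠ t in 𝓝[>] (0 : ℝ), t * ‖d‖ < ε := by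
    have : Tendsto (fun t : ℝ => t * ‖d‖) (𝓝 0) (𝓝 (0 * ‖d‖)) := 
      (continuous_id.mul continuous_const).tendsto 0
    exact (this.mono_left nhdsWithin_le_nhds).eventually_lt_const (by simpa using hε0)
  obtain ⟨t₀, ht₀, ht₁, ht₂, ht₃⟩ := (((eventually_mem_set.2 hIoo).and (e1.and (e2.and e3)))).exists
  set y := (e (γ t₀) - e (Φ u)) / v with hy
  have hyv : y * v = e (γ t₀) - e (Φ u) := div_mul_cancel₀ _ hv
  have hmem : ∀ s ∈ Set.Icc 0 t₀, u + (y - t₀ * d) + s * d ∈ Metric.ball u r := by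
    intro s hs
    rw [mem_ball_iff_norm]
    have : u + (y - t₀ * d) + s * d - u = y + ((s - t₀ : ℝ) : ℂ) * d := by push_cast; ring
    rw [this]
    calc _ ≤ ‖y‖ + ‖((s - t₀ : ℝ) : ℂ) * d‖ := norm_add_le _ _
      _ ≤ ‖y‖ + t₀ * ‖d‖ := by
        rw [norm_mul, Complex.norm_real, Real.norm_eq_abs]
        gcongr
        rw [abs_le]; constructor <;> linarith [hs.1, hs.2]
      _ < r := by linarith
  have hΦy : Φ (u + (y - t₀ * d) + t₀ * d) = γ t₀ := by
    have hb := (hball _ (hmem t₀ ⟨ht₀.1.le, le_rfl⟩)).1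
    apply e.injOn hb.1 ht₁
    rw [hb.2]
    linear_combination hyv
  have heq : Set.EqOn γ (fun s : ℝ => Φ (u + (y - t₀ * d) + s * d)) (Set.Ioc 0 t₀) := by
    refine eqOn_of_hasVelocityAt (S := S) (v := d * v) isPreconnected_Ioc
      (fun t ht => hvel t ⟨ht.1, ht.2.trans_lt ht₀.2⟩)
      (fun t ht => FlatAt.hasVelocityAt (hball _ (hmem t ⟨ht.1.le, ht.2⟩)).2) ⟨ht₀.1, le_rfl⟩
      hΦy.symm
  -- the curve starts at `Φ u`, which determines its position in the flat disc
  have hyt : y = t₀ * d := by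
    have hm0 := hball _ (hmem 0 ⟨le_rfl, ht₀.1.le⟩)
    have hl : Tendsto (fun s : ℝ => Φ (u + (y - t₀ * d) + s * d)) (𝓝[>] 0)
        (𝓝 (Φ (u + (y - t₀ * d) + (0 : ℝ) * d))) := by
      have : ContinuousAt (fun s : ℝ => Φ (u + (y - t₀ * d) + s * d)) 0 :=
        ContinuousAt.comp (g := Φ) (FlatAt.continuousAt hm0.2) (by fun_prop)
      exact this.tendsto.mono_left nhdsWithin_le_nhds
    have hl' := hlim0.congr' (eventually_of_mem (Ioc_mem_nhdsGT ht₀.1) heq)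
    have hpp := tendsto_nhds_unique hl hl'
    have h2 := hm0.1.2
    rw [hpp] at h2
    have : (y - t₀ * d) * v = 0 := by
      simp only [Complex.ofReal_zero, zero_mul, add_zero] at h2
      linear_combination -h2
    rcases mul_eq_zero.1 this with h | h
    · exact sub_eq_zero.1 h
    · exact absurd h hv
  have hγ : Set.EqOn γ (fun s : ℝ => Φ (u + s * d)) (Set.Ioo 0 1) := by
    refine eqOn_of_hasVelocityAt (S := S) (v := d * v) isPreconnected_Ioo hvel
      (fun t ht => FlatAt.hasVelocityAt (hΦ t (Set.Ioo_subset_Icc_self ht))) ht₀ ?_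
    rw [← hΦy, hyt]; simp
  have hIoo' : Set.Ioo (0 : ℝ) 1 ∈ 𝓝[<] (1 : ℝ) := Ioo_mem_nhdsLT one_pos
  have hlim1 : Tendsto γ (𝓝[<] 1) (𝓝 q) := by
    have := hc 1 (by simp)
    rw [ContinuousWithinAt, h1] at this
    exact this.mono_left (nhdsWithin_le_of_mem
      (mem_of_superset hIoo' Set.Ioo_subset_Icc_self))
  have hlim2 : Tendsto (fun s : ℝ => Φ (u + s * d)) (𝓝[<] 1) (𝓝 (Φ (u + (1 : ℝ) * d))) := by
    have : ContinuousAt (fun s : ℝ => Φ (u + s * d)) 1 :=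
      ContinuousAt.comp (g := Φ) (hΦ 1 (by simp)).continuousAt (by fun_prop)
    exact this.tendsto.mono_left nhdsWithin_le_nhds
  have := tendsto_nhds_unique (hlim1.congr' (eventually_of_mem hIoo' hγ)) hlim2
  simpa using this

theorem IsSegment.symm {p q : X} {d : ℂ} (h : S.IsSegment p q d) : S.IsSegment q p (-d) := by
  obtain ⟨γ, h0, h1, hc, hvel⟩ := h
  refine ⟨fun t => γ (1 - t), by simp [h1], by simp [h0], ?_, fun t ht => ?_⟩
  · refine hc.comp (by fun_prop) fun t ht => ?_
    constructor <;> linarith [ht.1, ht.2]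
  · rw [hasVelocityAt_iff]
    have := DevelopsAt.comp (f := fun t : ℝ => 1 - t) (s := t)
      (hasVelocityAt_iff.1 (hvel (1 - t) ⟨by linarith [ht.2], by linarith [ht.1]⟩)) (by fun_prop)
    exact this.congr_dev fun y => by simp only [Function.comp]; push_cast; ring

theorem flatDist_le_flatDist_swap (S : TranslationSurface X) (p q : X) :
    S.flatDist q p ≤ S.flatDist p q := by
  refine le_iInf fun n => le_iInf fun x => le_iInf fun d => le_iInf fun ⟨h0, hn, h⟩ => ?_
  refine iInf_le_of_le n <| iInf_le_of_le (fun i => x (n - i)) <|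
    iInf_le_of_le (fun i => -d (n - 1 - i)) <| iInf_le_of_le ⟨by simpa, by simpa, ?_⟩ ?_
  · intro i hi
    have h2 := (h (n - 1 - i) (by omega)).symm
    rw [show n - 1 - i + 1 = n - i by omega] at h2
    have h3 : n - (i + 1) = n - 1 - i := by omega
    simpa only [h3] using h2
  · simp only [norm_neg]
    rw [Finset.sum_range_reflect (fun i => ‖d i‖) n]

theorem flatDist_comm (S : TranslationSurface X) (p q : X) : S.flatDist p q = S.flatDist q p :=
  le_antisymm (S.flatDist_le_flatDist_swap q p) (S.flatDist_le_flatDist_swap p q)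

/-- A flat disc contains the metric ball of the same radius around its center, since broken lines
from the center that are shorter than the radius develop into the disc. -/
theorem exists_of_flatDist_lt [T2Space X] (hv : v ≠ 0) {ρ : ℝ} {q : X}
    (hΦ : ∀ w ∈ Metric.ball u ρ, S.FlatAt v Φ w)
    (h : S.flatDist (Φ u) q < ENNReal.ofReal (ρ * ‖v‖)) : ∃ w, ‖w‖ < ρ ∧ q = Φ (u + w) := by
  simp only [flatDist, iInf_lt_iff] at h
  obtain ⟨n, x, d, ⟨h0, hn, hseg⟩, hlt⟩ := h
  have hv0 : 0 < ‖v‖ := norm_pos_iff.2 hv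
  have hsum := (ENNReal.ofReal_lt_ofReal_iff_of_nonneg
    (Finset.sum_nonneg fun i _ => norm_nonneg (d i))).1 hlt
  have key : ∀ i ≤ n, ∃ w : ℂ, ‖w‖ * ‖v‖ ≤ ∑ j ∈ Finset.range i, ‖d j‖ ∧ x i = Φ (u + w) := by
    intro i
    induction i with
    | zero => exact fun _ => ⟨0, by simp, by simpa using h0⟩
    | succ i ih =>
      intro hi
      obtain ⟨w, hw, hxw⟩ := ih (by omega)
      have hs : ∑ j ∈ Finset.range i, ‖d j‖ + ‖d i‖ < ρ * ‖v‖ := by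
        rw [← Finset.sum_range_succ]
        exact (Finset.sum_le_sum_of_subset_of_nonneg
          (Finset.range_mono hi) fun _ _ _ => norm_nonneg _).trans_lt hsum
      have hdv : ‖d i / v‖ * ‖v‖ = ‖d i‖ := by rw [norm_div, div_mul_cancel₀ _ hv0.ne']
      refine ⟨w + d i / v, ?_, ?_⟩
      · rw [Finset.sum_range_succ]
        calc _ ≤ (‖w‖ + ‖d i / v‖) * ‖v‖ := by gcongr; exact norm_add_le _ _
          _ ≤ _ := by rw [add_mul, hdv]; linarith
      · have hsg := hseg i (by omega)
        rw [hxw, ← div_mul_cancel₀ (d i) hv] at hsg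
        rw [eq_of_isSegment hv ?_ hsg, add_assoc]
        intro t ht
        apply hΦ
        rw [mem_ball_iff_norm, add_assoc, add_sub_cancel_left]
        refine lt_of_mul_lt_mul_right ?_ hv0.le
        calc _ ≤ (‖w‖ + ‖(t : ℂ) * (d i / v)‖) * ‖v‖ := by gcongr; exact norm_add_le _ _
          _ ≤ (‖w‖ + ‖d i / v‖) * ‖v‖ := by
            gcongr
            rw [norm_mul, Complex.norm_real, Real.norm_eq_abs, abs_of_nonneg ht.1]
            exact mul_le_of_le_one_left (norm_nonneg _) ht.2
          _ < ρ * ‖v‖ := by rw [add_mul, hdv]; linarith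
  obtain ⟨w, hw, hxw⟩ := key n le_rfl
  exact ⟨w, lt_of_mul_lt_mul_right (hw.trans_lt hsum) hv0.le, hn ▸ hxw⟩

end Dist

/-! ### Upper bounds for the area, finiteness -/

section Area

theorem det_restrictScalars_toSpanSingleton (c : ℂ) :
    ((ContinuousLinearMap.toSpanSingleton ℂ c).restrictScalars ℝ).det = ‖c‖ ^ 2 := by
  rw [← Complex.normSq_eq_norm_sq, ← Algebra.norm_complex_apply, Algebra.norm_apply,
    ContinuousLinearMap.det]
  congr 1
  ext
  simp [mul_comm]

/-- A holomorphic map multiplies the planar measure by at most the square of a bound of its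
derivative. -/
theorem volume_image_le {O B : Set ℂ} (hO : IsOpen O) (hB : B ⊆ O) {g g' : ℂ → ℂ} {K : ℝ}
    (hg : ∀ z ∈ O, HasDerivAt g (g' z) z) (hK : ∀ z ∈ O, ‖g' z‖ ^ 2 ≤ K) :
    volume (g '' B) ≤ ENNReal.ofReal K * volume B := by
  set T := toMeasurable volume B ∩ O
  have hT : MeasurableSet T := (measurableSet_toMeasurable volume B).inter hO.measurableSet
  have hBT : B ⊆ T := Set.subset_inter (subset_toMeasurable _ _) hB
  calc volume (g '' B) ≤ volume (g '' T) := measure_mono (Set.image_mono hBT)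
    _ ≤ ∫⁻ z in T, ENNReal.ofReal
        |((ContinuousLinearMap.toSpanSingleton ℂ (g' z)).restrictScalars ℝ).det| :=
      addHaar_image_le_lintegral_abs_det_fderiv volume hT fun z hz =>
        ((hg z hz.2).hasFDerivAt.restrictScalars ℝ).hasFDerivWithinAt
    _ ≤ ∫⁻ z in T, ENNReal.ofReal K := by
      refine setLIntegral_mono measurable_const fun z hz => ENNReal.ofReal_le_ofReal ?_
      rw [det_restrictScalars_toSpanSingleton, abs_of_nonneg (by positivity)]
      exact hK z hz.2
    _ = ENNReal.ofReal K * volume T := by simp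
    _ ≤ ENNReal.ofReal K * volume B := by
      refine mul_le_mul' le_rfl ?_
      exact (measure_mono Set.inter_subset_left).trans (measure_toMeasurable B).le

theorem volume_preimage_chart_le {S : TranslationSurface X} {e e' : OpenPartialHomeomorph X ℂ}
    (he : e ∈ S.charts) (he' : e' ∈ S.charts) {A : Set X} (hA : A ⊆ e.source) :
    volume (e'.symm ⁻¹' A ∩ e'.target) ≤ volume (e.symm ⁻¹' A ∩ e.target) := by
  set O := e.target ∩ e.symm ⁻¹' e'.source
  have hO : IsOpen O := e.isOpen_inter_preimage_symm e'.open_source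
  set B := e.symm ⁻¹' A ∩ O
  have h1 : e'.symm ⁻¹' A ∩ e'.target ⊆ (fun z => e' (e.symm z)) '' B := by
    rintro w ⟨hwA, hw⟩
    have hwe : e'.symm w ∈ e.source := hA hwA
    refine ⟨e (e'.symm w), ⟨?_, e.map_source hwe, ?_⟩, ?_⟩
    · simpa [e.left_inv hwe] using hwA
    · simpa [e.left_inv hwe] using e'.map_target hw
    · simp [e.left_inv hwe, e'.right_inv hw]
  have hder : ∀ z ∈ O, HasDerivAt (fun z => e' (e.symm z)) 1 z := by
    rintro z ⟨hz, hz'⟩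
    have hc : Tendsto e.symm (𝓝 z) (𝓝 (e.symm z)) := e.symm.continuousAt hz
    have htr := hc.eventually (S.translation e he e' he' (e.symm z) ⟨e.map_target hz, hz'⟩)
    refine ((hasDerivAt_id z).const_add (e' (e.symm z) - z)).congr_of_eventuallyEq ?_
    filter_upwards [htr, e.open_target.mem_nhds hz] with w hw hwt
    rw [e.right_inv hwt, e.right_inv hz] at hw
    simp only [id]
    linear_combination hw
  calc _ ≤ volume ((fun z => e' (e.symm z)) '' B) := measure_mono h1
    _ ≤ ENNReal.ofReal 1 * volume B :=
      volume_image_le hO Set.inter_subset_right hder (by simp)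
    _ ≤ _ := by
      rw [ENNReal.ofReal_one, one_mul]
      exact measure_mono (Set.inter_subset_inter_right _ Set.inter_subset_left)

theorem secondCountableTopology [CompactSpace X] (S : TranslationSurface X) :
    SecondCountableTopology X := by
  have hch : ∀ p : X, ∃ e : OpenPartialHomeomorph X ℂ, p ∈ e.source := by
    intro p
    by_cases hp : p ∈ S.sing
    · obtain ⟨k, z, hpz, -⟩ := S.conical p hp
      exact ⟨z, hpz⟩
    · obtain ⟨e, -, hpe⟩ := S.exists_chart p hp
      exact ⟨e, hpe⟩
  choose e he using hch
  let _ : ChartedSpace ℂ X :=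
    { atlas := Set.range e
      chartAt := e
      mem_chart_source := he
      chart_mem_atlas := fun p => ⟨p, rfl⟩ }
  exact ChartedSpace.secondCountable_of_sigmaCompact ℂ X

variable [MeasurableSpace X] [BorelSpace X] {S : TranslationSurface X}

theorem map_symm_apply (e : OpenPartialHomeomorph X ℂ) {A : Set X} (hA : MeasurableSet A) :
    ((volume : Measure ℂ).restrict e.target).map e.symm A
      = volume (e.symm ⁻¹' A ∩ e.target) := by
  rw [Measure.map_apply_of_aemeasurable
    (e.continuousOn_symm.aemeasurable e.open_target.measurableSet) hA,
    Measure.restrict_apply' e.open_target.measurableSet]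

/-- In a chart, the area is at most the planar measure. The area is a supremum of measures, and a
measure above all of them is the planar measure on the source of the chart together with an infinite
measure off it. -/
theorem area_le_of_subset_source {e : OpenPartialHomeomorph X ℂ} (he : e ∈ S.charts) {Y : Set X}
    (hY : Y ⊆ e.source) : S.area Y ≤ volume (e '' Y) := by
  set ν : Measure X := ((volume : Measure ℂ).restrict e.target).map e.symm
    + (⊤ : Measure X).restrict e.sourceᶜ
  have hle : S.area ≤ ν := by
    refine iSup₂_le fun e' he' => Measure.le_iff.2 fun A hA => ?_
    have hs := e.open_source.measurableSet
    rw [← measure_inter_add_sdiff A hs, Measure.add_apply]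
    gcongr ?_ + ?_
    · rw [map_symm_apply _ (hA.inter hs)]
      refine (volume_preimage_chart_le he he' Set.inter_subset_right).trans ?_
      rw [map_symm_apply _ hA]
      exact measure_mono (Set.inter_subset_inter_left _
        (Set.preimage_mono Set.inter_subset_left))
    · rw [Measure.restrict_apply hA, Set.sdiff_eq]
      exact Measure.le_iff.1 le_top _ (hA.inter hs.compl)
  set T := toMeasurable volume (e '' Y)
  have hYT : Y ⊆ e.source ∩ e ⁻¹' (T ∩ e.target) := fun y hy =>
    ⟨hY hy, subset_toMeasurable _ _ ⟨y, hy, rfl⟩, e.map_source (hY hy)⟩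
  have hmeas : MeasurableSet (e.source ∩ e ⁻¹' (T ∩ e.target)) := by
    have : Measurable (e.source.domRestrict e) :=
      (continuousOn_iff_continuous_domRestrict.1 e.continuousOn).measurable
    have h2 := e.open_source.measurableSet.subtype_image
      (this ((measurableSet_toMeasurable volume (e '' Y)).inter e.open_target.measurableSet))
    convert h2 using 1
    ext x
    constructor
    · rintro ⟨hx, hxT⟩
      exact ⟨⟨x, hx⟩, hxT, rfl⟩
    · rintro ⟨⟨y, hy⟩, hyT, rfl⟩
      exact ⟨hy, hyT⟩
  calc S.area Y ≤ S.area (e.source ∩ e ⁻¹' (T ∩ e.target)) := measure_mono hYT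
    _ ≤ ν (e.source ∩ e ⁻¹' (T ∩ e.target)) := Measure.le_iff.1 hle _ hmeas
    _ = volume (e.symm ⁻¹' (e.source ∩ e ⁻¹' (T ∩ e.target)) ∩ e.target) := by
      rw [Measure.add_apply, map_symm_apply _ hmeas, Measure.restrict_apply hmeas]
      have : e.source ∩ e ⁻¹' (T ∩ e.target) ∩ e.sourceᶜ = ∅ := by
        ext x; simp +contextual
      rw [this, measure_empty, add_zero]
    _ ≤ volume T := by
      refine measure_mono ?_
      rintro w ⟨⟨-, hw, -⟩, hwt⟩
      have hw' : e (e.symm w) ∈ T := hw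
      rwa [e.right_inv hwt] at hw'
    _ = volume (e '' Y) := measure_toMeasurable _

theorem area_sing [T2Space X] : S.area S.sing = 0 := by
  have hs := S.sing_finite.measurableSet
  have hle : S.area ≤ (⊤ : Measure X).restrict S.singᶜ := by
    refine iSup₂_le fun e he => Measure.le_iff.2 fun A hA => ?_
    have h0 : e.symm ⁻¹' (A ∩ S.sing) ∩ e.target = ∅ := by
      rw [Set.eq_empty_iff_forall_notMem]
      rintro w ⟨⟨-, hw⟩, hwt⟩
      exact Set.disjoint_left.1 (S.disjoint_sing e he) (e.map_target hwt) hw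
    rw [← measure_inter_add_sdiff A hs, map_symm_apply _ (hA.inter hs), h0, measure_empty, zero_add,
      Measure.restrict_apply hA, Set.sdiff_eq]
    exact Measure.le_iff.1 le_top _ (hA.inter hs.compl)
  refine le_antisymm ((Measure.le_iff.1 hle _ hs).trans ?_) zero_le
  rw [Measure.restrict_apply hs]
  simp

/-- The area of the image of a set under a map that is, in charts, a holomorphic map with bounded
derivative. -/
theorem area_image_le {O B : Set ℂ} (hO : IsOpen O) (hB : B ⊆ O) {Φ : ℂ → X} {g g' : ℂ → ℂ} {K : ℝ}
    (hΦ : ∀ z ∈ O, S.DevelopsAt g Φ z)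
    (hg : ∀ z ∈ O, HasDerivAt g (g' z) z) (hK : ∀ z ∈ O, ‖g' z‖ ^ 2 ≤ K) :
    S.area (Φ '' B) ≤ ENNReal.ofReal K * volume B := by
  have hloc : ∀ z ∈ O, ∃ U ⊆ O, z ∈ U ∧ IsOpen U ∧
      ∀ Y ⊆ U, S.area (Φ '' Y) ≤ ENNReal.ofReal K * volume Y := by
    intro z hz
    obtain ⟨e, he, hze, h⟩ := hΦ z hz
    obtain ⟨U, hU, hUo, hzU⟩ := eventually_nhds_iff.1 h
    refine ⟨U ∩ O, Set.inter_subset_right, ⟨hzU, hz⟩, hUo.inter hO, fun Y hY => ?_⟩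
    have hsrc : Φ '' Y ⊆ e.source := by
      rintro _ ⟨y, hy, rfl⟩
      exact (hU y (hY hy).1).1
    have him : e '' (Φ '' Y) = (fun y => e (Φ z) + (g y - g z)) '' Y := by
      rw [Set.image_image]
      exact Set.image_congr fun y hy => (hU y (hY hy).1).2
    refine (area_le_of_subset_source he hsrc).trans ?_
    rw [him]
    exact volume_image_le (g' := g') hO (fun y hy => (hY hy).2)
      (fun y hy => ((hg y hy).sub_const _).const_add _) hK
  choose! U hUO hzU hUo hU using hloc
  obtain ⟨t, htO, htc, hcov⟩ := TopologicalSpace.countable_cover_nhdsWithin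
    (f := U) (s := O) fun z hz => mem_nhdsWithin_of_mem_nhds ((hUo z hz).mem_nhds (hzU z hz))
  rcases O.eq_empty_or_nonempty with rfl | hne
  · simp [Set.subset_empty_iff.1 hB]
  have htne : t.Nonempty := by
    obtain ⟨z, hz⟩ := hne
    have := hcov hz
    simp only [Set.mem_iUnion] at this
    obtain ⟨y, hy, -⟩ := this
    exact ⟨y, hy⟩
  obtain ⟨f, rfl⟩ := htc.exists_eq_range htne
  have hfO : ∀ n, f n ∈ O := fun n => htO ⟨n, rfl⟩
  set T := toMeasurable volume B
  have hD : ∀ n, MeasurableSet (disjointed (fun n => U (f n)) n) := fun n =>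
    MeasurableSet.disjointed (fun i => (hUo _ (hfO i)).measurableSet) n
  have hcover : B ⊆ ⋃ n, disjointed (fun n => U (f n)) n ∩ T := by
    rw [← Set.iUnion_inter, iUnion_disjointed]
    refine Set.subset_inter (hB.trans ?_) (subset_toMeasurable _ _)
    simpa using hcov
  calc S.area (Φ '' B) ≤ S.area (⋃ n, Φ '' (disjointed (fun n => U (f n)) n ∩ T)) := by
        rw [← Set.image_iUnion]; exact measure_mono (Set.image_mono hcover)
    _ ≤ ∑' n, S.area (Φ '' (disjointed (fun n => U (f n)) n ∩ T)) := measure_iUnion_le _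
    _ ≤ ∑' n, ENNReal.ofReal K * volume (disjointed (fun n => U (f n)) n ∩ T) :=
      ENNReal.tsum_le_tsum fun n => hU _ (hfO n) _
        (Set.inter_subset_left.trans (disjointed_subset (fun n => U (f n)) n))
    _ = ENNReal.ofReal K * volume (⋃ n, disjointed (fun n => U (f n)) n ∩ T) := by
      rw [ENNReal.tsum_mul_left, measure_iUnion]
      · exact fun i j hij => ((disjoint_disjointed _ hij).mono Set.inter_subset_left
          Set.inter_subset_left)
      · exact fun n => (hD n).inter (measurableSet_toMeasurable _ _)
    _ ≤ ENNReal.ofReal K * volume B := by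
      refine mul_le_mul' le_rfl ?_
      exact (measure_mono (Set.iUnion_subset fun n => Set.inter_subset_right)).trans
        (measure_toMeasurable B).le

theorem area_image_le_of_flatAt {O B : Set ℂ} (hO : IsOpen O) (hB : B ⊆ O) {Φ : ℂ → X} {v : ℂ}
    (hΦ : ∀ z ∈ O, S.FlatAt v Φ z) :
    S.area (Φ '' B) ≤ ENNReal.ofReal (‖v‖ ^ 2) * volume B :=
  area_image_le (g' := fun _ => v) hO hB hΦ
    (fun z _ => by simpa using (hasDerivAt_id z).mul_const v) (fun _ _ => le_rfl)

/-- The area is locally finite. Around a conical point this is the change of variables formula for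
`u ^ (k + 1)` on a punctured disc. -/
theorem finiteAtFilter_area [T2Space X] (p : X) : S.area.FiniteAtFilter (𝓝 p) := by
  by_cases hp : p ∈ S.sing
  · obtain ⟨k, z, hpz, hz0, hz⟩ := S.conical p hp
    obtain ⟨r, hr, hball⟩ := Metric.mem_nhds_iff.1 (z.open_target.mem_nhds (z.map_source hpz))
    rw [hz0] at hball
    set B := Metric.ball (0 : ℂ) r \ {0}
    have hBo : IsOpen B := Metric.isOpen_ball.sdiff isClosed_singleton
    have hdev : ∀ w ∈ B, S.DevelopsAt (fun w => w ^ (k + 1)) z.symm w := by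
      rintro w ⟨hw, hw0⟩
      have hwt := hball hw
      have hne : z.symm w ≠ p := by
        intro h
        apply hw0
        rw [Set.mem_singleton_iff, ← z.right_inv hwt, h, hz0]
      obtain ⟨e, he, hwe, hev⟩ := hz _ (z.map_target hwt) hne
      have hc : Tendsto z.symm (𝓝 w) (𝓝 (z.symm w)) := z.symm.continuousAt hwt
      refine ⟨e, he, hwe, ?_⟩
      filter_upwards [hc.eventually hev, hc.eventually (e.open_source.mem_nhds hwe),
        z.open_target.mem_nhds hwt] with y hy hye hyt
      refine ⟨hye, ?_⟩
      rw [z.right_inv hyt, z.right_inv hwt] at hy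
      linear_combination hy
    have harea : S.area (z.symm '' B) ≤ ENNReal.ofReal (((k + 1) * r ^ k) ^ 2) * volume B := by
      refine area_image_le (g' := fun w => (k + 1 : ℕ) * w ^ k) hBo subset_rfl hdev
        (fun w _ => by simpa using hasDerivAt_pow (k + 1) w) fun w hw => ?_
      have hw' : ‖w‖ < r := mem_ball_zero_iff.1 hw.1
      have : ‖((k + 1 : ℕ) : ℂ) * w ^ k‖ ≤ (k + 1) * r ^ k := by
        rw [norm_mul, norm_pow, Complex.norm_natCast]
        push_cast
        gcongr
      gcongr
    refine ⟨z.symm '' Metric.ball (0 : ℂ) r, ?_, ?_⟩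
    · have : IsOpen (z.symm '' Metric.ball (0 : ℂ) r) :=
        z.symm.isOpen_image_of_subset_source Metric.isOpen_ball hball
      exact this.mem_nhds ⟨0, Metric.mem_ball_self hr, by rw [← hz0, z.left_inv hpz]⟩
    · have hsub : z.symm '' Metric.ball (0 : ℂ) r ⊆ z.symm '' B ∪ S.sing := by
        rintro _ ⟨w, hw, rfl⟩
        by_cases hw0 : w = 0
        · right; rw [hw0, ← hz0, z.left_inv hpz]; exact hp
        · exact Or.inl ⟨w, ⟨hw, hw0⟩, rfl⟩
      calc _ ≤ S.area (z.symm '' B) + S.area S.sing :=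
            (measure_mono hsub).trans (measure_union_le _ _)
        _ ≤ ENNReal.ofReal (((k + 1) * r ^ k) ^ 2) * volume (Metric.ball (0 : ℂ) r) := by
          rw [area_sing, add_zero]
          refine harea.trans ?_
          gcongr
          exact Set.sdiff_subset
        _ < ∞ := ENNReal.mul_lt_top ENNReal.ofReal_lt_top measure_ball_lt_top
  · obtain ⟨e, he, hpe⟩ := S.exists_chart p hp
    obtain ⟨ε, hε, Φ, h0, hΦ⟩ := exists_hasFlatBall (S := S) 1 (C := Set.univ) univ_mem he hpe
    refine ⟨Φ '' Metric.ball 0 ε, ?_, ?_⟩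
    · rw [← h0]
      exact (isOpen_image_of_flatAt one_ne_zero Metric.isOpen_ball
        fun u hu => (hΦ u hu).1).mem_nhds ⟨0, Metric.mem_ball_self hε, rfl⟩
    · exact (area_image_le_of_flatAt Metric.isOpen_ball subset_rfl fun u hu => (hΦ u hu).1).trans_lt
        (ENNReal.mul_lt_top ENNReal.ofReal_lt_top measure_ball_lt_top)

theorem isFiniteMeasure_area [T2Space X] [CompactSpace X] (S : TranslationSurface X) :
    IsFiniteMeasure S.area :=
  ⟨isCompact_univ.measure_lt_top_of_nhdsWithin fun p _ =>
    (finiteAtFilter_area p).filter_mono nhdsWithin_le_nhds⟩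

end Area

/-! ### The linear flow -/

section Flow

variable {S : TranslationSurface X} {θ : ℝ} {p : X}

theorem norm_dir (θ : ℝ) : ‖dir θ‖ = 1 := by
  rw [← sq_eq_sq₀ (norm_nonneg _) zero_le_one, ← Complex.normSq_eq_norm_sq, Complex.normSq_apply]
  simp only [dir]
  linarith [Real.sin_sq_add_cos_sq θ]

theorem dir_ne_zero (θ : ℝ) : dir θ ≠ 0 := by
  rw [← norm_pos_iff, norm_dir]; exact one_pos

theorem reComp_sq_add_imComp_sq (v : ℂ) (θ : ℝ) :
    reComp v θ ^ 2 + imComp v θ ^ 2 = ‖v‖ ^ 2 := by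
  rw [← Complex.normSq_eq_norm_sq, Complex.normSq_apply, reComp, imComp]
  linear_combination (v.re ^ 2 + v.im ^ 2) * Real.sin_sq_add_cos_sq θ

/-- In the coordinate of a cylinder with development `v`, the flow in direction `θ` drifts away
from the closed geodesics at the speed `reComp v θ / ‖v‖ ^ 2`. -/
theorem im_dir_div (v : ℂ) (θ : ℝ) : (dir θ / v).im = reComp v θ / ‖v‖ ^ 2 := by
  rw [← Complex.normSq_eq_norm_sq, Complex.div_im, reComp, dir]
  ring

theorem flow_of_isOrbit [T2Space X] {γ : ℝ → X} (h : S.IsOrbit θ p γ) (t : ℝ) :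
    S.flow θ t p = γ t := by
  have hex : ∃ γ : ℝ → X, S.IsOrbit θ p γ := ⟨γ, h⟩
  rw [flow, dif_pos hex]
  have h' := hex.choose_spec
  exact eqOn_of_hasVelocityAt isPreconnected_univ (fun t _ => h'.2 t) (fun t _ => h.2 t)
    (Set.mem_univ 0) (h'.1.trans h.1.symm) (Set.mem_univ t)

theorem flow_of_not_exists (h : ¬ ∃ γ : ℝ → X, S.IsOrbit θ p γ) (t : ℝ) : S.flow θ t p = p := by
  rw [flow, dif_neg h]

theorem flow_neg_flow [T2Space X] (t : ℝ) : S.flow θ (-t) (S.flow θ t p) = p := by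
  by_cases h : ∃ γ : ℝ → X, S.IsOrbit θ p γ
  · obtain ⟨γ, hγ⟩ := h
    rw [flow_of_isOrbit hγ]
    have : S.IsOrbit θ (γ t) (fun s => γ (t + s)) := by
      refine ⟨by simp, fun s => ?_⟩
      rw [hasVelocityAt_iff]
      have := DevelopsAt.comp (f := fun s : ℝ => t + s) (s := s)
        (hasVelocityAt_iff.1 (hγ.2 (t + s))) (by fun_prop)
      exact this.congr_dev fun y => by simp only [Function.comp]; push_cast; ring
    rw [flow_of_isOrbit this]
    simp [hγ.1]
  · rw [flow_of_not_exists h, flow_of_not_exists h]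

/-- Forward and backward invariance give the exact invariance that ergodicity is stated for. -/
theorem preimage_flow_eq [T2Space X] {A : Set X} (hA : ∀ t, ∀ p ∈ A, S.flow θ t p ∈ A) (t : ℝ) :
    S.flow θ t ⁻¹' A = A := by
  ext p
  refine ⟨fun hp => ?_, hA t p⟩
  rw [← S.flow_neg_flow (θ := θ) (p := p) t]
  exact hA _ _ hp

/-- In the coordinate of a flat map the flow is a translation. The second case accounts for the
points on singular leaves, which the flow fixes by convention. -/
theorem flow_flatAt [T2Space X] {v : ℂ} {Φ : ℂ → X} {u : ℂ} (hv : v ≠ 0) {t : ℝ}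
    (h : ∀ s ∈ Set.uIcc 0 t, S.FlatAt v Φ (u + s * (dir θ / v))) :
    S.flow θ t (Φ u) = Φ (u + t * (dir θ / v)) ∨ S.flow θ t (Φ u) = Φ u := by
  by_cases hex : ∃ γ : ℝ → X, S.IsOrbit θ (Φ u) γ
  · left
    obtain ⟨γ, hγ⟩ := hex
    rw [flow_of_isOrbit hγ]
    refine eqOn_of_hasVelocityAt (S := S) (v := dir θ) (K := Set.uIcc 0 t) (t := 0)
      (γ' := fun t : ℝ => Φ (u + t * (dir θ / v)))
      isPreconnected_uIcc (fun s _ => hγ.2 s) (fun s hs => ?_) Set.left_mem_uIcc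
      (by simp [hγ.1]) Set.right_mem_uIcc
    have := (h s hs).hasVelocityAt
    rwa [div_mul_cancel₀ _ hv] at this
  · exact Or.inr (flow_of_not_exists hex t)

end Flow

/-! ### Cylinders as images of strips -/

section Strip

variable {S : TranslationSurface X} {v : ℂ} {C : Set X} {I : Set ℝ} {Φ : ℂ → X}

theorem isPreconnected_im_preimage (hI : I.OrdConnected) :
    IsPreconnected (Complex.im ⁻¹' I) :=
  (hI.convex.linear_preimage Complex.imLm).isPreconnected

theorem IsFoliated.ne_zero (h : S.IsFoliated v C) : v ≠ 0 := by
  obtain ⟨p, hp⟩ := h.2.1.nonempty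
  obtain ⟨γ, hγ, -⟩ := h.2.2 p hp
  exact hγ.1

theorem IsFoliated.exists_local_strip [T2Space X] (h : S.IsFoliated v C) {q : X} (hq : q ∈ C) :
    ∃ ε > 0, ∃ Φ : ℂ → X, Φ 0 = q ∧ ∀ u : ℂ, |u.im| < ε → S.FlatAt v Φ u ∧ Φ u ∈ C := by
  obtain ⟨γ, hγ, h0, hγC⟩ := h.2.2 q hq
  obtain ⟨ε, hε, hb⟩ := exists_forall_hasFlatBall h.1 (isCompact_Icc (a := (0 : ℝ)) (b := 1))
    (fun t _ => hγ.2.1 t) (fun t _ => hγC t)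
  have hb' : ∀ t, S.HasFlatBall v C ε (γ t) := by
    intro t
    have hp : Function.Periodic γ 1 := hγ.2.2.1
    have := hb (Int.fract t) ⟨Int.fract_nonneg t, (Int.fract_lt_one t).le⟩
    rwa [Int.fract, ← mul_one ((⌊t⌋ : ℤ) : ℝ), hp.sub_int_mul_eq] at this
  obtain ⟨Φ, hΦ, hΦγ⟩ := exists_flat_tube (S := S) (K := Set.univ) Set.ordConnected_univ
    (fun t _ => hγ.2.1 t) (fun t _ => hb' t) Complex.continuous_re (fun _ => Set.mem_univ _)
  refine ⟨ε, hε, Φ, ?_, fun u hu => hΦ u ?_⟩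
  · have := hΦγ 0 (Set.mem_univ _) (by simp)
    rw [← h0, ← this]; simp
  · have : u - u.re = u.im * Complex.I := by
      apply Complex.ext <;> simp
    rw [this]
    simpa using hu

/-- `Φ` exhibits `C` as the image of the strip `ℝ × I`, where `Φ` is flat and has period `1`. The
closed geodesics of `C` are the images of the horizontal lines. Such a map is not asserted to be
injective modulo the period. -/
structure IsStripMap (S : TranslationSurface X) (v : ℂ) (C : Set X) (I : Set ℝ) (Φ : ℂ → X) :
    Prop where
  ne_zero : v ≠ 0
  isOpen : IsOpen I
  ordConnected : I.OrdConnected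
  flatAt : ∀ u : ℂ, u.im ∈ I → S.FlatAt v Φ u
  image_eq : Φ '' (Complex.im ⁻¹' I) = C
  periodic : ∀ u : ℂ, u.im ∈ I → ∀ n : ℤ, Φ (u + n) = Φ u

/-- A foliated set is the image of a strip: the maximal strip around a leaf that develops into the
set has a relatively closed image. -/
theorem IsFoliated.exists_isStripMap [T2Space X] (h : S.IsFoliated v C) :
    ∃ I Φ, S.IsStripMap v C I Φ := by
  have hv := h.ne_zero
  obtain ⟨p, hp⟩ := h.2.1.nonempty
  let P : Set ℝ → (ℂ → X) → Prop := fun J Φ => IsOpen J ∧ J.OrdConnected ∧ (0 : ℝ) ∈ J ∧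
    Φ 0 = p ∧ ∀ u : ℂ, u.im ∈ J → S.FlatAt v Φ u ∧ Φ u ∈ C
  set 𝒥 : Set (Set ℝ) := {J | ∃ Φ, P J Φ}
  set I := ⋃₀ 𝒥
  have hIo : IsOpen I := isOpen_sUnion fun J ⟨_, hJ⟩ => hJ.1
  have hI : I.OrdConnected :=
    (isPreconnected_sUnion 0 𝒥 (fun J ⟨_, hJ⟩ => hJ.2.2.1)
      fun J ⟨_, hJ⟩ => hJ.2.1.isPreconnected).ordConnected
  have hloc : ∀ u : ℂ, u.im ∈ I → ∃ J Ψ, P J Ψ ∧ u.im ∈ J := fun u ⟨J, ⟨Ψ, hJ⟩, hu⟩ =>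
    ⟨J, Ψ, hJ, hu⟩
  have hne : Nonempty (ℂ → X) := ⟨fun _ => p⟩
  choose! J Ψ hJ huJ using hloc
  set Φ : ℂ → X := fun u => Ψ u u
  have huniq : ∀ J₁ Φ₁, P J₁ Φ₁ → ∀ u : ℂ, u.im ∈ J₁ → Φ u = Φ₁ u := by
    intro J₁ Φ₁ h₁ u hu
    have huI : u.im ∈ I := ⟨J₁, ⟨Φ₁, h₁⟩, hu⟩
    have h₂ := hJ u huI
    exact eqOn_of_flatAt (S := S) (v := v) (u := 0) (D := Complex.im ⁻¹' (J u ∩ J₁))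
      (isPreconnected_im_preimage (h₂.2.1.inter h₁.2.1))
      (fun y hy => (h₂.2.2.2.2 y hy.1).1) (fun y hy => (h₁.2.2.2.2 y hy.2).1)
      ⟨by simpa using h₂.2.2.1, by simpa using h₁.2.2.1⟩
      (h₂.2.2.2.1.trans h₁.2.2.2.1.symm) ⟨huJ u huI, hu⟩
  have hflat : ∀ u : ℂ, u.im ∈ I → S.FlatAt v Φ u ∧ Φ u ∈ C := by
    intro u hu
    have h₂ := hJ u hu
    refine ⟨DevelopsAt.congr (h₂.2.2.2.2 u (huJ u hu)).1 ?_, (h₂.2.2.2.2 u (huJ u hu)).2⟩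
    filter_upwards [(h₂.1.preimage Complex.continuous_im).mem_nhds (huJ u hu)] with y hy
    exact huniq _ _ h₂ y hy
  have hDo : IsOpen (Complex.im ⁻¹' I) := hIo.preimage Complex.continuous_im
  obtain ⟨ε₀, hε₀, Φ₀, hΦ₀, hΦ₀'⟩ := h.exists_local_strip hp
  have hP₀ : P (Set.Ioo (-ε₀) ε₀) Φ₀ := ⟨isOpen_Ioo, Set.ordConnected_Ioo, by simpa using hε₀, hΦ₀,
    fun u hu => hΦ₀' u (abs_lt.2 hu)⟩
  have h0I : (0 : ℝ) ∈ I := ⟨_, ⟨_, hP₀⟩, hP₀.2.2.1⟩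
  have hΦ0 : Φ 0 = p := by rw [huniq _ _ hP₀ 0 (by simpa using hε₀), hΦ₀]
  have hUo : IsOpen (Φ '' (Complex.im ⁻¹' I)) :=
    isOpen_image_of_flatAt hv hDo fun u hu => (hflat u hu).1
  have hCU : C ⊆ Φ '' (Complex.im ⁻¹' I) := by
    refine h.2.1.isPreconnected.subset_of_closure_inter_subset hUo
      ⟨p, hp, 0, by simpa using h0I, hΦ0⟩ ?_
    rintro q ⟨hqcl, hqC⟩
    obtain ⟨ε, hε, Φq, hq0, hΦq⟩ := h.exists_local_strip hqC
    have hVo : IsOpen (Φq '' (Complex.im ⁻¹' Set.Ioo (-ε) ε)) :=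
      isOpen_image_of_flatAt hv (isOpen_Ioo.preimage Complex.continuous_im)
        fun u hu => (hΦq u (abs_lt.2 hu)).1
    obtain ⟨_, ⟨u₁, hu₁, rfl⟩, ⟨u₂, hu₂, hu₁₂⟩⟩ := mem_closure_iff.1 hqcl _ hVo
      ⟨0, by simpa using hε, hq0⟩
    -- the strip around `q` extends the maximal strip, hence is contained in it
    set c := u₁ - u₂ with hc
    set J' := (fun y : ℝ => c.im + y) ⁻¹' Set.Ioo (-ε) ε
    have hJ'o : IsOpen J' := isOpen_Ioo.preimage (by fun_prop)
    have hJ' : J'.OrdConnected := by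
      have : J' = Set.Ioo (-ε - c.im) (ε - c.im) := by
        ext y; simp only [J', Set.mem_preimage, Set.mem_Ioo]
        constructor <;> rintro ⟨h1, h2⟩ <;> constructor <;> linarith
      rw [this]; exact Set.ordConnected_Ioo
    have hcu₂ : c + u₂ = u₁ := by rw [hc]; ring
    have hu₂J : u₂.im ∈ J' := by
      change c.im + u₂.im ∈ Set.Ioo (-ε) ε
      rw [← Complex.add_im, hcu₂]; exact hu₁
    have hq' : ∀ y : ℂ, y.im ∈ J' → S.FlatAt v (fun y => Φq (c + y)) y ∧ Φq (c + y) ∈ C := by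
      intro y hy
      have := hΦq (c + y) (by rw [Complex.add_im]; exact abs_lt.2 hy)
      exact ⟨this.1.comp_add, this.2⟩
    have heq : Set.EqOn Φ (fun y => Φq (c + y)) (Complex.im ⁻¹' (I ∩ J')) :=
      eqOn_of_flatAt (S := S) (v := v) (u := u₂) (isPreconnected_im_preimage (hI.inter hJ'))
        (fun y hy => (hflat y hy.1).1) (fun y hy => (hq' y hy.2).1) ⟨hu₂, hu₂J⟩
        (by rw [hu₁₂, hcu₂])
    classical
    set Θ : ℂ → X := fun y => if y.im ∈ I then Φ y else Φq (c + y)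
    have hΘq : ∀ y : ℂ, y.im ∈ J' → Θ y = Φq (c + y) := by
      intro y hy
      by_cases hyI : y.im ∈ I
      · simp only [Θ, if_pos hyI]; exact heq ⟨hyI, hy⟩
      · simp only [Θ, if_neg hyI]
    have hPΘ : P (I ∪ J') Θ := by
      refine ⟨hIo.union hJ'o, ?_, Or.inl h0I, ?_, ?_⟩
      · exact (IsPreconnected.union u₂.im hu₂ hu₂J hI.isPreconnected hJ'.isPreconnected).ordConnected
      · simp only [Θ, Complex.zero_im, if_pos h0I, hΦ0]
      · rintro y (hy | hy)
        · refine ⟨DevelopsAt.congr (hflat y hy).1 ?_, by simpa only [Θ, if_pos hy] using (hflat y hy).2⟩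
          filter_upwards [hDo.mem_nhds hy] with z hz
          exact if_pos hz
        · refine ⟨DevelopsAt.congr (hq' y hy).1 ?_, by rw [hΘq y hy]; exact (hq' y hy).2⟩
          filter_upwards [(hJ'o.preimage Complex.continuous_im).mem_nhds hy] with z hz
          exact hΘq z hz
    have hmem : (-c).im ∈ J' := by
      change c.im + (-c).im ∈ Set.Ioo (-ε) ε
      simpa using hε
    refine ⟨-c, ⟨_, ⟨_, hPΘ⟩, Or.inr hmem⟩, ?_⟩
    rw [huniq _ _ hPΘ _ (Or.inr hmem), hΘq _ hmem, add_neg_cancel, hq0]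
  refine ⟨I, Φ, hv, hIo, hI, fun u hu => (hflat u hu).1, Set.Subset.antisymm ?_ hCU, ?_⟩
  · rintro _ ⟨u, hu, rfl⟩
    exact (hflat u hu).2
  · intro u hu n
    obtain ⟨γ, hγ, h0, -⟩ := h.2.2 _ (hflat u hu).2
    have heq : Set.EqOn γ (fun s : ℝ => Φ (u + s * 1)) Set.univ := by
      refine eqOn_of_hasVelocityAt (S := S) (v := v) (t := 0) isPreconnected_univ
        (fun t _ => hγ.2.1 t) (fun t _ => ?_) (Set.mem_univ _) (by simp [h0])
      have := FlatAt.hasVelocityAt (S := S) (v := v) (Φ := Φ) (c := u) (d := 1) (t := t)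
        (hflat _ (by simpa using hu)).1
      simpa using this
    have hp : Function.Periodic γ 1 := hγ.2.2.1
    have h1 := heq (Set.mem_univ (n : ℝ))
    have h2 : γ n = γ 0 := by simpa using hp.int_mul_eq n
    rw [h2, h0] at h1
    simpa using h1.symm

/-- The points of the strip `ℝ × I` at distance more than `η` from its boundary. Distances in the
strip are those on the cylinder divided by the circumference `‖v‖`. -/
def stripCore (I : Set ℝ) (η : ℝ) : Set ℂ := {u | u.im - η ∈ I ∧ u.im + η ∈ I}

theorem isOpen_stripCore (hI : IsOpen I) (η : ℝ) : IsOpen (stripCore I η) :=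
  (hI.preimage (f := fun u : ℂ => u.im - η) (by fun_prop)).inter
    (hI.preimage (f := fun u : ℂ => u.im + η) (by fun_prop))

theorem im_add_mem_of_mem_stripCore (hI : I.OrdConnected) {η : ℝ} {u x : ℂ}
    (hu : u ∈ stripCore I η) (hx : |x.im| ≤ η) : (u + x).im ∈ I := by
  refine hI.out hu.1 hu.2 ?_
  rw [Complex.add_im]
  constructor <;> linarith [abs_le.1 hx]

theorem add_mem_stripCore (hI : I.OrdConnected) {η η' : ℝ} {u x : ℂ}
    (hu : u ∈ stripCore I η) (hη' : 0 ≤ η') (hx : |x.im| + η' ≤ η) : u + x ∈ stripCore I η' := by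
  have := abs_le.1 (show |x.im| ≤ η - η' by linarith)
  constructor <;> refine hI.out hu.1 hu.2 ?_ <;> rw [Complex.add_im] <;>
    constructor <;> linarith

theorem volume_reProdIm (s t : Set ℝ) :
    volume (s ×ℂ t) = volume s * volume t := by
  have h := Complex.volume_preserving_equiv_real_prod.measure_preimage_equiv (s ×ˢ t)
  rw [Measure.volume_eq_prod, Measure.prod_prod] at h
  rw [← h]
  congr 1

/-- The points of an interval at distance at most `η` from one given end have diameter at most `η`,
also when the interval is unbounded. -/
theorem volume_collar_le (hI : I.OrdConnected) {η : ℝ} (hη : 0 ≤ η) :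
    volume {y | y ∈ I ∧ ¬ (y - η ∈ I ∧ y + η ∈ I)} ≤ ENNReal.ofReal (2 * η) := by
  have h1 : volume {y | y ∈ I ∧ y - η ∉ I} ≤ ENNReal.ofReal η := by
    refine (Real.volume_le_diam _).trans (Metric.ediam_le fun x hx y hy => ?_)
    rw [edist_dist, Real.dist_eq]
    refine ENNReal.ofReal_le_ofReal (abs_le.2 ⟨?_, ?_⟩) <;> by_contra! hlt
    · exact hy.2 (hI.out hx.1 hy.1 ⟨by linarith, by linarith⟩)
    · exact hx.2 (hI.out hy.1 hx.1 ⟨by linarith, by linarith⟩)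
  have h2 : volume {y | y ∈ I ∧ y + η ∉ I} ≤ ENNReal.ofReal η := by
    refine (Real.volume_le_diam _).trans (Metric.ediam_le fun x hx y hy => ?_)
    rw [edist_dist, Real.dist_eq]
    refine ENNReal.ofReal_le_ofReal (abs_le.2 ⟨?_, ?_⟩) <;> by_contra! hlt
    · exact hx.2 (hI.out hx.1 hy.1 ⟨by linarith, by linarith⟩)
    · exact hy.2 (hI.out hy.1 hx.1 ⟨by linarith, by linarith⟩)
  calc _ ≤ volume ({y | y ∈ I ∧ y - η ∉ I} ∪ {y | y ∈ I ∧ y + η ∉ I}) := by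
        refine measure_mono fun y ⟨hy, hy'⟩ => ?_
        by_cases h : y - η ∈ I
        · exact Or.inr ⟨hy, fun h' => hy' ⟨h, h'⟩⟩
        · exact Or.inl ⟨hy, h⟩
    _ ≤ ENNReal.ofReal η + ENNReal.ofReal η := (measure_union_le _ _).trans (add_le_add h1 h2)
    _ = _ := by rw [← ENNReal.ofReal_add hη hη, two_mul]

/-- The pairs `(p, p')` of points of a cylinder with `p` in the core and `p'` on a closed geodesic
at distance less than `η`, in the strip, from that of `p`. -/
def nearPairs (I : Set ℝ) (Φ : ℂ → X) (η : ℝ) : Set (X × X) :=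
  {q | ∃ u x : ℂ, u ∈ stripCore I η ∧ |x.im| < η ∧ q = (Φ u, Φ (u + x))}

namespace IsStripMap

theorem isOpen_image_stripCore (h : S.IsStripMap v C I Φ) {η : ℝ} (hη : 0 ≤ η) :
    IsOpen (Φ '' stripCore I η) :=
  isOpen_image_of_flatAt h.ne_zero (isOpen_stripCore h.isOpen η) fun u hu => h.flatAt u <| by
    simpa using im_add_mem_of_mem_stripCore h.ordConnected hu (x := 0) (by simpa using hη)

theorem isOpen_nearPairs (h : S.IsStripMap v C I Φ) (η : ℝ) :
    IsOpen (nearPairs I Φ η) := by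
  rw [isOpen_iff_mem_nhds]
  rintro _ ⟨u, x, hu, hx, rfl⟩
  have hη : 0 ≤ η := (abs_nonneg _).trans hx.le
  have h1 : S.FlatAt v Φ u := h.flatAt u <| by
    simpa using im_add_mem_of_mem_stripCore h.ordConnected hu (x := 0) (by simpa using hη)
  have h2 := h.flatAt _ (im_add_mem_of_mem_stripCore h.ordConnected hu hx.le)
  rw [nhds_prod_eq, ← h1.map_nhds h.ne_zero, ← h2.map_nhds h.ne_zero, Filter.prod_map_map_eq,
    ← nhds_prod_eq]
  have hopen : IsOpen {z : ℂ × ℂ | z.1 ∈ stripCore I η ∧ |(z.2 - z.1).im| < η} :=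
    ((isOpen_stripCore h.isOpen η).preimage continuous_fst).inter
      (isOpen_lt (continuous_abs.comp (Complex.continuous_im.comp
        (continuous_snd.sub continuous_fst))) continuous_const)
  refine mem_of_superset (image_mem_map (hopen.mem_nhds ⟨hu, by simpa using hx⟩)) ?_
  rintro _ ⟨⟨y, y'⟩, ⟨hy, hy'⟩, rfl⟩
  exact ⟨y, y' - y, hy, hy', by simp⟩

/-- The drift of the flow in the coordinate of a cylinder. The displacement `x` is zero for a
point on a singular leaf, which is why the first bound is not an equation. -/
theorem flow_mem [T2Space X] (h : S.IsStripMap v C I Φ) {η : ℝ} {u : ℂ}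
    (hu : u ∈ stripCore I η) {θ t : ℝ} {κ : ℝ} (hκ : κ ≤ η) (ht : |t| * |reComp v θ| ≤ κ * ‖v‖ ^ 2) :
    ∃ x : ℂ, |x.im| * ‖v‖ ^ 2 ≤ |t| * |reComp v θ| ∧ S.flow θ t (Φ u) = Φ (u + x) := by
  have hv2 : 0 < ‖v‖ ^ 2 := by have := norm_pos_iff.2 h.ne_zero; positivity
  have him : ∀ s : ℝ, |((s : ℂ) * (dir θ / v)).im| * ‖v‖ ^ 2 = |s| * |reComp v θ| := by
    intro s
    rw [Complex.im_ofReal_mul, im_dir_div, abs_mul, abs_div, abs_of_pos hv2, mul_assoc,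
      div_mul_cancel₀ _ hv2.ne']
  have hfl : ∀ s ∈ Set.uIcc 0 t, S.FlatAt v Φ (u + s * (dir θ / v)) := by
    intro s hs
    refine h.flatAt _ (im_add_mem_of_mem_stripCore h.ordConnected hu ?_)
    refine le_of_mul_le_mul_right ?_ hv2
    rw [him]
    have hst : |s| ≤ |t| := by simpa using Set.abs_sub_left_of_mem_uIcc hs
    calc |s| * |reComp v θ| ≤ |t| * |reComp v θ| := by gcongr
      _ ≤ κ * ‖v‖ ^ 2 := ht
      _ ≤ η * ‖v‖ ^ 2 := by gcongr
  rcases flow_flatAt h.ne_zero hfl with h1 | h1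
  · exact ⟨_, (him t).le, h1⟩
  · exact ⟨0, by simpa using by positivity, by simpa using h1⟩

theorem flow_mem_image_stripCore [T2Space X] (h : S.IsStripMap v C I Φ) {η : ℝ} (hη : 0 ≤ η)
    {p : X} (hp : p ∈ Φ '' stripCore I η) {θ t : ℝ} (ht : |t| * |reComp v θ| ≤ η / 2 * ‖v‖ ^ 2) :
    S.flow θ t p ∈ Φ '' stripCore I (η / 2) := by
  have hv2 : 0 < ‖v‖ ^ 2 := by have := norm_pos_iff.2 h.ne_zero; positivity
  obtain ⟨u, hu, rfl⟩ := hp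
  obtain ⟨x, hx, hfx⟩ := h.flow_mem hu (by linarith) ht
  have : |x.im| ≤ η / 2 := le_of_mul_le_mul_right (hx.trans ht) hv2
  exact ⟨u + x, add_mem_stripCore h.ordConnected hu (by positivity) (by linarith), hfx.symm⟩

/-- As long as the drift is less than half the distance to the boundary of the cylinder, an orbit
only comes close to points on neighbouring closed geodesics. -/
theorem mem_nearPairs_of_flatDist_lt [T2Space X] (h : S.IsStripMap v C I Φ) {η : ℝ}
    {p p' : X} (hp : p ∈ Φ '' stripCore I η) {θ t : ℝ}
    (ht : |t| * |reComp v θ| < η / 2 * ‖v‖ ^ 2)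
    (hd : S.flatDist (S.flow θ t p) p' < ENNReal.ofReal (η / 2 * ‖v‖)) :
    (p, p') ∈ nearPairs I Φ η := by
  have hv2 : 0 < ‖v‖ ^ 2 := by have := norm_pos_iff.2 h.ne_zero; positivity
  have hη : 0 < η / 2 := by
    have : 0 < η / 2 * ‖v‖ ^ 2 := lt_of_le_of_lt (by positivity) ht
    exact pos_of_mul_pos_left this hv2.le
  obtain ⟨u, hu, rfl⟩ := hp
  obtain ⟨x, hx, hfx⟩ := h.flow_mem hu (by linarith) ht.le
  have hx' : |x.im| < η / 2 := lt_of_mul_lt_mul_right (hx.trans_lt ht) hv2.le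
  rw [hfx] at hd
  have hsum : ∀ w : ℂ, ‖w‖ < η / 2 → |(x + w).im| < η := by
    intro w hw
    rw [Complex.add_im]
    calc _ ≤ |x.im| + |w.im| := abs_add_le _ _
      _ < η := by linarith [Complex.abs_im_le_norm w]
  have hfl : ∀ w ∈ Metric.ball (u + x) (η / 2), S.FlatAt v Φ w := by
    intro w hw
    have h2 := hsum (w - (u + x)) (mem_ball_iff_norm.1 hw)
    have := im_add_mem_of_mem_stripCore h.ordConnected hu h2.le
    rw [show u + (x + (w - (u + x))) = w by ring] at this
    exact h.flatAt w this
  obtain ⟨w, hw, rfl⟩ := exists_of_flatDist_lt h.ne_zero hfl hd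
  exact ⟨u, x + w, hu, hsum w hw, by rw [add_assoc]⟩

variable [MeasurableSpace X] [BorelSpace X]

theorem area_image_le (h : S.IsStripMap v C I Φ) {Y : Set ℝ} (hY : Y ⊆ I) :
    S.area (Φ '' (Complex.im ⁻¹' Y)) ≤ ENNReal.ofReal (‖v‖ ^ 2) * volume Y := by
  have hsub : Φ '' (Complex.im ⁻¹' Y) ⊆ Φ '' (Set.Ico 0 1 ×ℂ Y) := by
    rintro _ ⟨u, hu, rfl⟩
    refine ⟨u + (-⌊u.re⌋ : ℤ), ⟨?_, by simpa using hu⟩, h.periodic u (hY hu) _⟩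
    have : (u + (-⌊u.re⌋ : ℤ)).re = Int.fract u.re := by
      simp [Int.fract, sub_eq_add_neg]
    simp only [Set.mem_preimage, this]
    exact ⟨Int.fract_nonneg _, Int.fract_lt_one _⟩
  refine (measure_mono hsub).trans ((area_image_le_of_flatAt
    (h.isOpen.preimage Complex.continuous_im) (fun u hu => hY hu.2) h.flatAt).trans ?_)
  rw [volume_reProdIm]
  simp

theorem area_diff_le (h : S.IsStripMap v C I Φ) {η : ℝ} (hη : 0 ≤ η) :
    S.area (C \ Φ '' stripCore I η) ≤ ENNReal.ofReal (2 * η * ‖v‖ ^ 2) := by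
  have hsub : C \ Φ '' stripCore I η ⊆
      Φ '' (Complex.im ⁻¹' {y | y ∈ I ∧ ¬ (y - η ∈ I ∧ y + η ∈ I)}) := by
    rintro q ⟨hq, hq'⟩
    rw [← h.image_eq] at hq
    obtain ⟨u, hu, rfl⟩ := hq
    exact ⟨u, ⟨hu, fun hc => hq' ⟨u, hc, rfl⟩⟩, rfl⟩
  calc _ ≤ _ := measure_mono hsub
    _ ≤ ENNReal.ofReal (‖v‖ ^ 2) * _ := h.area_image_le fun y hy => hy.1
    _ ≤ ENNReal.ofReal (‖v‖ ^ 2) * ENNReal.ofReal (2 * η) :=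
      mul_le_mul' le_rfl (volume_collar_le h.ordConnected hη)
    _ = _ := by rw [← ENNReal.ofReal_mul (by positivity), mul_comm]

theorem area_nearPairs_section_le [T2Space X] (h : S.IsStripMap v C I Φ) (η : ℝ)
    (p : X) :
    S.area {p' | (p, p') ∈ nearPairs I Φ η} ≤ ENNReal.ofReal (2 * η * ‖v‖ ^ 2) := by
  rcases Set.eq_empty_or_nonempty {p' | (p, p') ∈ nearPairs I Φ η} with he | ⟨p₀, hp₀⟩
  · rw [he]; simp
  obtain ⟨u₀, _, hu₀, -, hpu₀⟩ := hp₀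
  have hp : p = Φ u₀ := congrArg Prod.fst hpu₀
  have hfl : ∀ u ∈ stripCore I η, ∀ y ∈ Complex.im ⁻¹' Set.Ioo (-η) η,
      S.FlatAt v (fun y => Φ (u + y)) y := fun u hu y hy =>
    (h.flatAt _ (im_add_mem_of_mem_stripCore h.ordConnected hu (abs_lt.2 hy).le)).comp_add
  have hsub : {p' | (p, p') ∈ nearPairs I Φ η} ⊆
      Φ '' (Complex.im ⁻¹' Set.Ioo (u₀.im - η) (u₀.im + η)) := by
    rintro p' ⟨u, x, hu, hx, hpu⟩
    have h0 : (0 : ℂ) ∈ Complex.im ⁻¹' Set.Ioo (-η) η := by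
      have : 0 < η := (abs_nonneg _).trans_lt hx
      simpa using this
    have := eqOn_of_flatAt (isPreconnected_im_preimage Set.ordConnected_Ioo) (hfl u hu)
      (hfl u₀ hu₀) h0 (by simpa using (congrArg Prod.fst hpu).symm.trans hp) (abs_lt.1 hx)
    refine ⟨u₀ + x, ?_, ?_⟩
    · have := abs_lt.1 hx
      simp only [Set.mem_preimage, Complex.add_im, Set.mem_Ioo]
      constructor <;> linarith
    · rw [show p' = Φ (u + x) from congrArg Prod.snd hpu]; exact this.symm
  calc _ ≤ _ := measure_mono hsub
    _ ≤ ENNReal.ofReal (‖v‖ ^ 2) * volume (Set.Ioo (u₀.im - η) (u₀.im + η)) :=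
      h.area_image_le fun y hy => h.ordConnected.out hu₀.1 hu₀.2 (Set.Ioo_subset_Icc_self hy)
    _ = _ := by
      rw [Real.volume_Ioo, ← ENNReal.ofReal_mul (by positivity)]
      congr 1; ring

end IsStripMap

end Strip

/-! ### Lower bounds for hitting exponents -/

section Hitting

variable {S : TranslationSurface X} {θ : ℝ} {p p' : X}

theorem le_limsupHitting {c : ℝ}
    (h : ∃ᶠ r in 𝓝[>] (0 : ℝ), ENNReal.ofReal (r ^ (-c)) ≤ S.hittingTime θ p p' r) :
    (c : EReal) ≤ S.limsupHitting θ p p' := by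
  refine le_limsup_of_frequently_le ?_
  refine (h.and_eventually (Ioo_mem_nhdsGT (one_pos (α := ℝ)))).mono ?_
  rintro r ⟨hr, hr0, hr1⟩
  have hlog : 0 < -Real.log r := neg_pos.2 (Real.log_neg hr0 hr1)
  rw [EReal.le_div_iff_mul_le (by exact_mod_cast hlog) (EReal.coe_ne_top _), ← EReal.coe_mul]
  refine le_trans (le_of_eq ?_) (ENNReal.log_monotone hr)
  rw [ENNReal.log_ofReal_of_pos (Real.rpow_pos_of_pos hr0 _), Real.log_rpow hr0]
  congr 1
  ring

theorem le_hittingTime {r T : ℝ}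
    (h : ∀ t, r < t → S.flatDist (S.flow θ t p) p' < ENNReal.ofReal r → T ≤ t) :
    ENNReal.ofReal T ≤ S.hittingTime θ p p' r :=
  le_iInf₂ fun t ht => ENNReal.ofReal_le_ofReal (h t ht.1 ht.2)

end Hitting

/-! ### The limsup hitting exponent is at least one -/

section Discs

variable {S : TranslationSurface X} {θ : ℝ}

/-- The pairs `(q, p')` such that `p'` lies at distance less than `r` from the center `q` of a flat
disc of radius more than `r`. -/
def discPairs (S : TranslationSurface X) (r : ℝ) : Set (X × X) :=
  {q | ∃ ρ > r, ∃ Ψ : ℂ → X, (∀ u ∈ Metric.ball (0 : ℂ) ρ, S.FlatAt 1 Ψ u) ∧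
    ∃ w : ℂ, ‖w‖ < r ∧ q = (Ψ 0, Ψ w)}

theorem isOpen_discPairs (S : TranslationSurface X) (r : ℝ) : IsOpen (S.discPairs r) := by
  rw [isOpen_iff_mem_nhds]
  rintro _ ⟨ρ, hρ, Ψ, hΨ, w, hw, rfl⟩
  have hr : 0 < r := (norm_nonneg _).trans_lt hw
  have h1 := hΨ 0 (Metric.mem_ball_self (hr.trans hρ))
  have h2 := hΨ w (mem_ball_zero_iff.2 (hw.trans hρ))
  rw [nhds_prod_eq, ← h1.map_nhds one_ne_zero, ← h2.map_nhds one_ne_zero, Filter.prod_map_map_eq,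
    ← nhds_prod_eq]
  have hopen : IsOpen {z : ℂ × ℂ | ‖z.1‖ < ρ - r ∧ ‖z.2 - z.1‖ < r} :=
    (isOpen_lt continuous_fst.norm continuous_const).inter
      (isOpen_lt (continuous_snd.sub continuous_fst).norm continuous_const)
  refine mem_of_superset (image_mem_map (hopen.mem_nhds ⟨by simpa using hρ, by simpa using hw⟩)) ?_
  rintro _ ⟨⟨y, y'⟩, ⟨hy, hy'⟩, rfl⟩
  refine ⟨ρ - ‖y‖, by linarith [hy], fun u => Ψ (y + u), fun u hu => FlatAt.comp_add (hΨ _ ?_),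
    y' - y, hy', by simp⟩
  rw [mem_ball_zero_iff] at hu ⊢
  linarith [norm_add_le y u]

/-- The pairs `(p, p')` such that the orbit of `p` is defined up to the time `T`, where it arrives
at a point `q` with `(q, p')` in `discPairs S r`. -/
def reachPairs (S : TranslationSurface X) (θ T r : ℝ) : Set (X × X) :=
  {q | ∃ γ : ℝ → X, γ 0 = q.1 ∧ (∀ t ∈ Set.Icc 0 T, S.HasVelocityAt γ (dir θ) t) ∧
    (γ T, q.2) ∈ S.discPairs r}

theorem isOpen_reachPairs [T2Space X] (S : TranslationSurface X) (θ : ℝ) {T : ℝ} (hT : 0 ≤ T)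
    (r : ℝ) : IsOpen (S.reachPairs θ T r) := by
  rw [isOpen_iff_mem_nhds]
  rintro ⟨p, p'⟩ ⟨γ, h0, hγ, hp'⟩
  simp only at h0 hp'
  obtain ⟨ε, hε, hb⟩ := exists_forall_hasFlatBall (C := Set.univ) isOpen_univ isCompact_Icc hγ
    fun _ _ => Set.mem_univ _
  obtain ⟨Φ, hΦ, hΦγ⟩ := exists_flat_tube (S := S) (π := fun u => Set.projIcc 0 T hT u.re)
    Set.ordConnected_Icc hγ hb (by fun_prop) (fun u => (Set.projIcc 0 T hT u.re).2)
  have hproj : ∀ t ∈ Set.Icc 0 T, (Set.projIcc 0 T hT t : ℝ) = t := fun t ht => by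
    rw [Set.projIcc_of_mem hT ht]
  have hfl : ∀ t ∈ Set.Icc 0 T, S.FlatAt (dir θ) Φ t := fun t ht => by
    refine (hΦ t ?_).1
    rw [Complex.ofReal_re, hproj t ht]
    simpa using hε
  have hγΦ : ∀ t ∈ Set.Icc 0 T, Φ t = γ t := fun t ht =>
    hΦγ t ht (by rw [Complex.ofReal_re, hproj t ht])
  have h0mem : (0 : ℝ) ∈ Set.Icc 0 T := ⟨le_rfl, hT⟩
  have hTmem : T ∈ Set.Icc 0 T := ⟨hT, le_rfl⟩
  have hev1 : ∀ᶠ x : ℂ in 𝓝 0, ∀ t ∈ Set.Icc 0 T, S.FlatAt (dir θ) Φ (x + (t : ℝ)) := by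
    refine isCompact_Icc.eventually_forall_of_forall_eventually
      (P := fun (x : ℂ) (t : ℝ) => S.FlatAt (dir θ) Φ (x + t)) fun t ht => ?_
    have hc : ContinuousAt (fun z : ℂ × ℝ => z.1 + z.2) (0, t) := by fun_prop
    have := (hfl t ht).eventually
    rw [show (t : ℂ) = (0, t).1 + ((0, t) : ℂ × ℝ).2 by simp] at this
    exact hc.eventually this
  have hev2 : ∀ᶠ z : ℂ × X in 𝓝 (0, p'), (Φ (z.1 + T), z.2) ∈ S.discPairs r := by
    have hc : ContinuousAt (fun z : ℂ × X => (Φ (z.1 + T), z.2)) (0, p') := by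
      refine ContinuousAt.prodMk (ContinuousAt.comp (g := Φ) ?_ (by fun_prop)) (by fun_prop)
      simpa using FlatAt.continuousAt (hfl T hTmem)
    refine hc.eventually ((S.isOpen_discPairs r).mem_nhds ?_)
    simpa [hγΦ T hTmem] using hp'
  have hev : ∀ᶠ z : ℂ × X in 𝓝 0 ×ˢ 𝓝 p', (∀ t ∈ Set.Icc 0 T, S.FlatAt (dir θ) Φ (z.1 + (t : ℝ))) ∧
      (Φ (z.1 + T), z.2) ∈ S.discPairs r := by
    rw [nhds_prod_eq] at hev2
    exact (tendsto_fst.eventually hev1).and hev2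
  have hmap : map Φ (𝓝 0) = 𝓝 p := by
    have h1 := (hfl 0 h0mem).map_nhds (dir_ne_zero θ)
    rwa [hγΦ 0 h0mem, h0, Complex.ofReal_zero] at h1
  have hmap2 : map (Prod.map Φ id) (𝓝 0 ×ˢ 𝓝 p') = 𝓝 (p, p') := by
    rw [← Filter.prod_map_map_eq', hmap, Filter.map_id, nhds_prod_eq]
  rw [← hmap2]
  refine mem_of_superset (image_mem_map hev) ?_
  rintro _ ⟨⟨x, y⟩, ⟨hx, hy⟩, rfl⟩
  refine ⟨fun t => Φ (x + t * 1), by simp, fun t ht => ?_, by simpa using hy⟩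
  have := FlatAt.hasVelocityAt (S := S) (v := dir θ) (Φ := Φ) (c := x) (d := 1) (t := t)
    (by simpa using hx t ht)
  simpa using this

/-- An orbit that comes close to the center of a flat disc at the time `t` is still in the disc at
the last multiple of `r` before `t`. -/
theorem exists_mem_reachPairs [T2Space X] {p p' : X} {d r t : ℝ} (hr : 0 < r) (hd : 4 * r < d)
    (hp' : S.HasFlatBall 1 Set.univ d p') (ht : 0 ≤ t)
    (h : S.flatDist (S.flow θ t p) p' < ENNReal.ofReal r) :
    ∃ j : ℕ, j * r ≤ t ∧ (p, p') ∈ S.reachPairs θ (j * r) (2 * r) := by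
  obtain ⟨Ψ, hΨ0, hΨ⟩ := hp'
  rw [flatDist_comm, ← hΨ0, show r = r * ‖(1 : ℂ)‖ by simp] at h
  obtain ⟨w, hw, hfw⟩ := exists_of_flatDist_lt one_ne_zero
    (fun w hw => (hΨ w (Metric.ball_subset_ball (by linarith) hw)).1) h
  rw [zero_add] at hfw
  have hdisc : ∀ y : ℂ, ‖y‖ < 2 * r → (Ψ y, p') ∈ S.discPairs (2 * r) := by
    intro y hy
    refine ⟨d - 2 * r, by linarith, fun u => Ψ (y + u), fun u hu => FlatAt.comp_add (hΨ _ ?_).1,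
      -y, by simpa using hy, by simp [hΨ0]⟩
    rw [mem_ball_zero_iff] at hu ⊢
    linarith [norm_add_le y u]
  by_cases hex : ∃ γ : ℝ → X, S.IsOrbit θ p γ
  · obtain ⟨γ, hγ⟩ := hex
    rw [flow_of_isOrbit hγ] at hfw
    have hj := Nat.floor_le (div_nonneg ht hr.le)
    have hj' := Nat.lt_floor_add_one (t / r)
    set j := ⌊t / r⌋₊
    have hjt : j * r ≤ t := by rwa [le_div_iff₀ hr] at hj
    have hjt' : t < j * r + r := by
      rw [div_lt_iff₀ hr] at hj'; linarith
    have hnorm : ∀ s ∈ Set.Icc (j * r) t, ‖w + ((s - t : ℝ) : ℂ) * dir θ‖ < 2 * r := by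
      intro s hs
      calc _ ≤ ‖w‖ + ‖((s - t : ℝ) : ℂ) * dir θ‖ := norm_add_le _ _
        _ = ‖w‖ + (t - s) := by
          rw [norm_mul, norm_dir, mul_one, Complex.norm_real, Real.norm_eq_abs,
            abs_of_nonpos (by linarith [hs.2])]
          ring
        _ < 2 * r := by linarith [hs.1]
    have heq : Set.EqOn γ (fun s : ℝ => Ψ (w - t * dir θ + s * dir θ)) (Set.Icc (j * r) t) := by
      refine eqOn_of_hasVelocityAt (S := S) (v := dir θ) (t := t) isPreconnected_Icc
        (fun s _ => hγ.2 s) (fun s hs => ?_) ⟨hjt, le_rfl⟩ (by simpa using hfw)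
      have := FlatAt.hasVelocityAt (S := S) (v := 1) (Φ := Ψ) (c := w - t * dir θ) (d := dir θ)
        (t := s) (hΨ _ ?_).1
      · simpa using this
      · rw [mem_ball_zero_iff, show w - t * dir θ + s * dir θ = w + ((s - t : ℝ) : ℂ) * dir θ by
          push_cast; ring]
        linarith [hnorm s hs]
    refine ⟨j, hjt, γ, hγ.1, fun s _ => hγ.2 s, ?_⟩
    simp only
    rw [heq ⟨le_rfl, hjt⟩]
    refine hdisc _ ?_
    have := hnorm _ ⟨le_rfl, hjt⟩
    rwa [show w - t * dir θ + (j * r : ℝ) * dir θ = w + ((j * r - t : ℝ) : ℂ) * dir θ by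
      push_cast; ring]
  · rw [flow_of_not_exists hex] at hfw
    refine ⟨0, by simpa, fun s => Ψ (w + s * dir θ), by simp [hfw], fun s hs => ?_, ?_⟩
    · have hs0 : s = 0 := by
        have h2 := hs.2
        simp only [Nat.cast_zero, zero_mul] at h2
        exact le_antisymm h2 hs.1
      have := FlatAt.hasVelocityAt (S := S) (v := 1) (Φ := Ψ) (c := w) (d := dir θ) (t := s)
        (hΨ _ ?_).1
      · simpa using this
      · rw [mem_ball_zero_iff, hs0]
        simp only [Complex.ofReal_zero, zero_mul, add_zero]
        linarith
    · simpa using hdisc w (by linarith)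

variable [MeasurableSpace X] [BorelSpace X]

theorem area_discPairs_section_le [T2Space X] (S : TranslationSurface X) (r : ℝ) (q : X) :
    S.area {p' | (q, p') ∈ S.discPairs r} ≤ ENNReal.ofReal (Real.pi * r ^ 2) := by
  rcases Set.eq_empty_or_nonempty {p' | (q, p') ∈ S.discPairs r} with he | ⟨p₀, hp₀⟩
  · rw [he]; simp
  obtain ⟨ρ₀, hρ₀, Ψ₀, hΨ₀, w₀, hw₀, hq₀⟩ := hp₀
  have hr : 0 < r := (norm_nonneg _).trans_lt hw₀
  have hsub : {p' | (q, p') ∈ S.discPairs r} ⊆ Ψ₀ '' Metric.ball 0 r := by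
    rintro p' ⟨ρ, hρ, Ψ, hΨ, w, hw, hq⟩
    have hwb : w ∈ Metric.ball (0 : ℂ) r := mem_ball_zero_iff.2 hw
    refine ⟨w, hwb, ?_⟩
    rw [show p' = Ψ w from congrArg Prod.snd hq]
    exact eqOn_of_flatAt (S := S) (v := 1) (convex_ball (0 : ℂ) r).isPreconnected
      (fun y hy => hΨ₀ y (Metric.ball_subset_ball hρ₀.le hy))
      (fun y hy => hΨ y (Metric.ball_subset_ball hρ.le hy)) (Metric.mem_ball_self hr)
      ((congrArg Prod.fst hq₀).symm.trans (congrArg Prod.fst hq)) hwb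
  calc _ ≤ _ := measure_mono hsub
    _ ≤ ENNReal.ofReal (‖(1 : ℂ)‖ ^ 2) * volume (Metric.ball (0 : ℂ) r) :=
      area_image_le_of_flatAt Metric.isOpen_ball subset_rfl
        fun y hy => hΨ₀ y (Metric.ball_subset_ball hρ₀.le hy)
    _ = _ := by
      rw [Complex.volume_ball, norm_one, one_pow, ENNReal.ofReal_one, one_mul,
        ← ENNReal.ofReal_pow hr.le, mul_comm, ← NNReal.coe_real_pi,
        ENNReal.ofReal_mul NNReal.pi.coe_nonneg, ENNReal.ofReal_coe_nnreal]

theorem area_reachPairs_section_le [T2Space X] (S : TranslationSurface X) (θ : ℝ) {T : ℝ}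
    (hT : 0 ≤ T) (r : ℝ) (p : X) :
    S.area {p' | (p, p') ∈ S.reachPairs θ T r} ≤ ENNReal.ofReal (Real.pi * r ^ 2) := by
  rcases Set.eq_empty_or_nonempty {p' | (p, p') ∈ S.reachPairs θ T r} with he | ⟨p₀, hp₀⟩
  · rw [he]; simp
  obtain ⟨γ₀, h₀, hγ₀, -⟩ := hp₀
  refine (measure_mono ?_).trans (S.area_discPairs_section_le r (γ₀ T))
  rintro p' ⟨γ, h, hγ, hp'⟩
  have : γ₀ T = γ T := eqOn_of_hasVelocityAt isPreconnected_Icc hγ₀ hγ (t := 0) ⟨le_rfl, hT⟩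
    (h₀.trans h.symm) ⟨hT, le_rfl⟩
  simp only [Set.mem_ofPred_eq, this]
  exact hp'

variable [CompactSpace X] [T2Space X]

/-- A Borel-Cantelli lemma: sections of summable areas are left eventually by almost all
pairs. -/
theorem ae_prod_eventually_notMem (S : TranslationSurface X) {B : ℕ → Set (X × X)}
    (hB : ∀ n, IsOpen (B n)) {f : ℕ → ℝ} (hf : Summable f)
    (hsec : ∀ n p, S.area {p' | (p, p') ∈ B n} ≤ ENNReal.ofReal (f n)) :
    ∀ᵐ q ∂(S.area.prod S.area), ∀ᶠ n in atTop, q ∉ B n := by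
  have := S.secondCountableTopology
  have := S.isFiniteMeasure_area
  refine ae_eventually_notMem (ne_top_of_le_ne_top
    (ENNReal.mul_ne_top hf.tsum_ofReal_ne_top (measure_ne_top S.area Set.univ)) ?_)
  rw [← ENNReal.tsum_mul_right]
  refine ENNReal.tsum_le_tsum fun n => ?_
  rw [Measure.prod_apply (hB n).measurableSet]
  exact (lintegral_mono fun p => hsec n p).trans (by simp)

/-- Almost every pair has limsup hitting exponent at least `1`, on every translation surface and in
every direction: up to the time `T`, the `r`-neighbourhood of an orbit has area of order `r * T`,
apart from the vicinity of the conical points. -/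
theorem ae_le_limsupHitting_of_lt_one (S : TranslationSurface X) (θ : ℝ) {c : ℝ} (hc : c < 1) :
    ∀ᵐ q ∂(S.area.prod S.area), (c : EReal) ≤ S.limsupHitting θ q.1 q.2 := by
  have := S.isFiniteMeasure_area
  -- negative exponents are irrelevant, so `c` may be increased to a number in `[0, 1)`
  wlog hc0 : 0 ≤ c generalizing c
  · filter_upwards [this (c := 0) one_pos le_rfl] with q hq
    exact le_trans (by exact_mod_cast (not_le.1 hc0).le) hq
  set r : ℕ → ℝ := fun n => (1 / 2) ^ n with hr
  have hr0 : ∀ n, 0 < r n := fun n => by positivity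
  have hr1 : ∀ n, r n ≤ 1 := fun n => pow_le_one₀ (by norm_num) (by norm_num)
  set N : ℕ → ℕ := fun n => ⌊r n ^ (-c) / r n⌋₊ + 1
  set B : ℕ → Set (X × X) := fun n => ⋃ j ∈ Finset.range (N n), S.reachPairs θ (j * r n) (2 * r n)
  have hBo : ∀ n, IsOpen (B n) := fun n => isOpen_biUnion fun j _ =>
    S.isOpen_reachPairs θ (mul_nonneg (Nat.cast_nonneg _) (hr0 n).le) _
  have hsec : ∀ n p, S.area {p' | (p, p') ∈ B n} ≤
      ENNReal.ofReal (8 * Real.pi * ((1 / 2 : ℝ) ^ (1 - c)) ^ n) := by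
    intro n p
    have hsub : {p' | (p, p') ∈ B n} ⊆
        ⋃ j ∈ Finset.range (N n), {p' | (p, p') ∈ S.reachPairs θ (j * r n) (2 * r n)} := by
      intro p' hp'
      simpa [B] using hp'
    calc _ ≤ _ := measure_mono hsub
      _ ≤ ∑ j ∈ Finset.range (N n), ENNReal.ofReal (Real.pi * (2 * r n) ^ 2) :=
        (measure_biUnion_finset_le _ _).trans (Finset.sum_le_sum fun j _ =>
          S.area_reachPairs_section_le θ (mul_nonneg (Nat.cast_nonneg _) (hr0 n).le) _ p)
      _ = ENNReal.ofReal (N n * (Real.pi * (2 * r n) ^ 2)) := by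
        rw [Finset.sum_const, Finset.card_range, nsmul_eq_mul,
          ENNReal.ofReal_mul (Nat.cast_nonneg _), ENNReal.ofReal_natCast]
      _ ≤ _ := by
        refine ENNReal.ofReal_le_ofReal ?_
        have hpow : r n ^ (1 - c) = ((1 / 2 : ℝ) ^ (1 - c)) ^ n := by
          simp only [hr]
          rw [← Real.rpow_natCast, ← Real.rpow_natCast, ← Real.rpow_mul (by norm_num),
            ← Real.rpow_mul (by norm_num), mul_comm]
        rw [← hpow]
        have hN : (N n : ℝ) ≤ r n ^ (-c) / r n + 1 := by
          push_cast [N]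
          gcongr
          exact Nat.floor_le (by have := hr0 n; positivity)
        have e1 : r n ^ (-c) * r n = r n ^ (1 - c) := by
          rw [← Real.rpow_add_one (hr0 n).ne']; congr 1; ring
        have e2 : r n ^ 2 ≤ r n ^ (1 - c) := by
          rw [← Real.rpow_natCast]
          exact Real.rpow_le_rpow_of_exponent_ge (hr0 n) (hr1 n) (by push_cast; linarith)
        calc _ ≤ (r n ^ (-c) / r n + 1) * (Real.pi * (2 * r n) ^ 2) := by gcongr
          _ = 4 * Real.pi * (r n ^ (-c) * r n + r n ^ 2) := by
            have := (hr0 n).ne'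
            field_simp
            ring
          _ ≤ 4 * Real.pi * (r n ^ (1 - c) + r n ^ (1 - c)) := by rw [e1]; gcongr
          _ = _ := by ring
  have hsum : Summable fun n : ℕ => 8 * Real.pi * ((1 / 2 : ℝ) ^ (1 - c)) ^ n :=
    (summable_geometric_of_lt_one (by positivity)
      (Real.rpow_lt_one (by norm_num) (by norm_num) (by linarith))).mul_left _
  have hns : ∀ᵐ q ∂(S.area.prod S.area), q.2 ∉ S.sing :=
    Measure.quasiMeasurePreserving_snd.ae (measure_eq_zero_iff_ae_notMem.1 area_sing)
  filter_upwards [S.ae_prod_eventually_notMem hBo hsum hsec, hns] with q hq hqs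
  obtain ⟨e, he, hqe⟩ := S.exists_chart _ hqs
  obtain ⟨d, hd, hball⟩ := exists_hasFlatBall (S := S) 1 (C := Set.univ) univ_mem he hqe
  have hlim : Tendsto r atTop (𝓝 0) :=
    tendsto_pow_atTop_nhds_zero_of_lt_one (by norm_num) (by norm_num)
  have hlim' : Tendsto r atTop (𝓝[>] 0) :=
    tendsto_nhdsWithin_iff.2 ⟨hlim, Eventually.of_forall hr0⟩
  have hsmall : ∀ᶠ n in atTop, r n < d / 4 := hlim.eventually_lt_const (by positivity)
  refine le_limsupHitting (hlim'.frequently (Eventually.frequently ?_))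
  filter_upwards [hq, hsmall] with n hn hdn
  refine le_hittingTime fun t hrt hdist => ?_
  by_contra! hlt
  obtain ⟨j, hj, hmem⟩ := exists_mem_reachPairs (hr0 n) (by linarith) hball
    ((hr0 n).le.trans hrt.le) hdist
  refine hn (Set.mem_iUnion₂.2 ⟨j, ?_, hmem⟩)
  rw [Finset.mem_range, Nat.lt_add_one_iff]
  refine Nat.le_floor ?_
  rw [le_div_iff₀ (hr0 n)]
  linarith

end Discs

/-! ### Cylinders of bounded circumference -/

section Cylinders

theorem setOf_frequently_mem_eq {α : Type*} (E : ℕ → Set α) :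
    {x | ∃ᶠ n in atTop, x ∈ E n} = ⋂ N, ⋃ n ≥ N, E n := by
  ext x
  simp [frequently_atTop]

theorem measurableSet_frequently_mem {α : Type*} [MeasurableSpace α] {E : ℕ → Set α}
    (hE : ∀ n, MeasurableSet (E n)) : MeasurableSet {x | ∃ᶠ n in atTop, x ∈ E n} := by
  rw [setOf_frequently_mem_eq]
  exact MeasurableSet.iInter fun N => MeasurableSet.iUnion fun n => MeasurableSet.iUnion fun _ => hE n

theorem le_measure_frequently_mem {α : Type*} [MeasurableSpace α] {μ : Measure α}
    [IsFiniteMeasure μ] {E : ℕ → Set α} (hE : ∀ n, MeasurableSet (E n)) {b : ℝ≥0∞}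
    (hb : ∀ n, b ≤ μ (E n)) : b ≤ μ {x | ∃ᶠ n in atTop, x ∈ E n} := by
  rw [setOf_frequently_mem_eq]
  refine ge_of_tendsto' (tendsto_measure_iInter_atTop (μ := μ) (fun N => ?_) ?_
    ⟨0, measure_ne_top _ _⟩) fun N => (hb N).trans (measure_mono ?_)
  · exact (MeasurableSet.iUnion fun n => MeasurableSet.iUnion fun _ => hE n).nullMeasurableSet
  · exact fun N N' h => Set.biUnion_subset_biUnion_left fun n hn => le_trans h hn
  · exact Set.subset_biUnion_of_mem (u := fun n => E n) (le_refl N)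

variable {S : TranslationSurface X}

/-- Two cylinders with the same development are equal or disjoint. -/
theorem IsCylinder.eq_of_inter {v : ℂ} {C C' : Set X} (h : S.IsCylinder v C)
    (h' : S.IsCylinder v C') (hne : (C ∩ C').Nonempty) : C = C' := by
  have hU : S.IsFoliated v (C ∪ C') := by
    refine ⟨h.prop.1.union h'.prop.1, IsConnected.union hne h.prop.2.1 h'.prop.2.1, ?_⟩
    rintro p (hp | hp)
    · obtain ⟨γ, hγ, h0, hC⟩ := h.prop.2.2 p hp
      exact ⟨γ, hγ, h0, fun t => Or.inl (hC t)⟩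
    · obtain ⟨γ, hγ, h0, hC⟩ := h'.prop.2.2 p hp
      exact ⟨γ, hγ, h0, fun t => Or.inr (hC t)⟩
  exact (Maximal.eq_of_subset h hU Set.subset_union_left).trans
    (Maximal.eq_of_subset h' hU Set.subset_union_right).symm

/-- Cylinders whose cores share a point `p` and whose developments are close are parallel: the
closed geodesic of the second through `p` remains in the first, where it closes up only if the
developments are equal. -/
theorem IsStripMap.development_eq [T2Space X] {v v' : ℂ} {C C' : Set X} {I : Set ℝ} {Φ Ψ : ℂ → X}
    (h : S.IsStripMap v C I Φ) (h' : S.IsFoliated v' C') {η ε : ℝ} {p : X}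
    (hp : p ∈ Φ '' stripCore I η) (hp' : p ∈ C') (hΨ0 : Ψ 0 = p)
    (hΨ : ∀ u ∈ Metric.ball (0 : ℂ) ε, S.FlatAt 1 Ψ u ∧ (Ψ u = p → u = 0))
    (hη : ‖v' - v‖ < η * ‖v‖) (hε : ‖v' - v‖ < ε) : v' = v := by
  have hv := h.ne_zero
  have hv0 : 0 < ‖v‖ := norm_pos_iff.2 hv
  obtain ⟨u, hu, rfl⟩ := hp
  obtain ⟨γ, hγ, h0, -⟩ := h'.2.2 _ hp'
  set x := (v' - v) / v with hx
  have hxv : x * v = v' - v := div_mul_cancel₀ _ hv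
  have hxη : ‖x‖ < η := by rwa [hx, norm_div, div_lt_iff₀ hv0]
  have hη0 : 0 < η := (norm_nonneg _).trans_lt hxη
  have hfl : ∀ y : ℂ, ‖y‖ < η → S.FlatAt v Φ (u + y) := fun y hy =>
    h.flatAt _ (im_add_mem_of_mem_stripCore h.ordConnected hu
      ((Complex.abs_im_le_norm y).trans hy.le))
  have heq : Set.EqOn γ (fun t : ℝ => Φ (u + t * (1 + x))) (Set.Icc 0 1) := by
    refine eqOn_of_hasVelocityAt (S := S) (v := v') (t := 0) isPreconnected_Icc
      (fun t _ => hγ.2.1 t) (fun t ht => ?_) (by simp) (by simp [h0])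
    have := FlatAt.hasVelocityAt (S := S) (v := v) (Φ := Φ) (c := u) (d := 1 + x) (t := t)
      (h.flatAt _ (im_add_mem_of_mem_stripCore h.ordConnected hu ?_))
    · rwa [add_mul, hxv, one_mul, add_sub_cancel] at this
    · rw [Complex.im_ofReal_mul, Complex.add_im, Complex.one_im, zero_add, abs_mul,
        abs_of_nonneg ht.1]
      exact (mul_le_of_le_one_left (abs_nonneg _) ht.2).trans
        ((Complex.abs_im_le_norm x).trans hxη.le)
  have h1 : Φ (u + x) = Φ u := by
    have h2 := heq (show (1 : ℝ) ∈ Set.Icc (0 : ℝ) 1 by simp)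
    have h3 : γ 1 = γ 0 := by simpa using hγ.2.2.1 0
    have h4 := h.periodic (u + x) (im_add_mem_of_mem_stripCore h.ordConnected hu
      ((Complex.abs_im_le_norm x).trans hxη.le)) 1
    simp only [Complex.ofReal_one, one_mul] at h2
    rw [h3, h0] at h2
    rw [← h4, h2]
    congr 1
    push_cast
    ring
  have hΨΦ : Set.EqOn (fun y => Φ (u + y)) (fun y => Ψ (y * v))
      (Metric.ball 0 η ∩ Metric.ball 0 (ε / ‖v‖)) := by
    refine eqOn_of_flatAt (S := S) (v := v) (u := 0)
      ((convex_ball _ _).inter (convex_ball _ _)).isPreconnected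
      (fun y hy => (hfl y (mem_ball_zero_iff.1 hy.1)).comp_add) (fun y hy => ?_)
      ⟨Metric.mem_ball_self hη0, Metric.mem_ball_self (div_pos ((norm_nonneg _).trans_lt hε) hv0)⟩
      (by simp [hΨ0])
    have := FlatAt.comp_mul (S := S) (v := 1) (Φ := Ψ) (u := y) (c := v) (hΨ _ ?_).1
    · rwa [mul_one] at this
    · have := mem_ball_zero_iff.1 hy.2
      rwa [lt_div_iff₀ hv0, ← norm_mul, ← mem_ball_zero_iff] at this
  have h5 := hΨΦ (x := x) ⟨mem_ball_zero_iff.2 hxη, by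
    rwa [mem_ball_zero_iff, lt_div_iff₀ hv0, ← norm_mul, hxv]⟩
  simp only [h1, hxv] at h5
  exact sub_eq_zero.1 ((hΨ (v' - v) (mem_ball_zero_iff.2 hε)).2 h5.symm)

variable [MeasurableSpace X] [BorelSpace X]

theorem IsStripMap.ofReal_le_area_core {v : ℂ} {C : Set X} {I : Set ℝ} {Φ : ℂ → X}
    (h : S.IsStripMap v C I Φ) {a : ℝ} (ha : 0 < a) (hC : ENNReal.ofReal a ≤ S.area C) :
    ENNReal.ofReal (a / 2) ≤ S.area (Φ '' stripCore I (a / (4 * ‖v‖ ^ 2))) := by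
  have hv0 : 0 < ‖v‖ := norm_pos_iff.2 h.ne_zero
  set E := Φ '' stripCore I (a / (4 * ‖v‖ ^ 2))
  have h1 := h.area_diff_le (η := a / (4 * ‖v‖ ^ 2)) (by positivity)
  have h2 : 2 * (a / (4 * ‖v‖ ^ 2)) * ‖v‖ ^ 2 = a / 2 := by field_simp; ring
  rw [h2] at h1
  have h3 : ENNReal.ofReal (a / 2) + ENNReal.ofReal (a / 2) ≤ S.area E + ENNReal.ofReal (a / 2) := by
    rw [← ENNReal.ofReal_add (by positivity) (by positivity), add_halves]
    calc _ ≤ S.area C := hC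
      _ ≤ S.area (E ∪ C \ E) := measure_mono <| by
        rw [Set.union_sdiff_self]; exact Set.subset_union_right
      _ ≤ S.area E + S.area (C \ E) := measure_union_le _ _
      _ ≤ _ := add_le_add le_rfl h1
  exact (ENNReal.add_le_add_iff_right ENNReal.ofReal_ne_top).1 h3

variable [CompactSpace X] [T2Space X]

/-- There are finitely many cylinders of area bounded below and of circumference bounded above: the
cores of infinitely many cylinders would share a point, and among these two would have close
developments. -/
theorem finite_setOf_isCylinder (S : TranslationSurface X) {a : ℝ} (ha : 0 < a) (M : ℝ) :
    {C : Set X | ENNReal.ofReal a ≤ S.area C ∧ ∃ v, S.IsCylinder v C ∧ ‖v‖ ≤ M}.Finite := by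
  have := S.isFiniteMeasure_area
  by_contra hinf
  set f := Set.Infinite.natEmbedding _ hinf
  have hfa : ∀ n, ENNReal.ofReal a ≤ S.area (f n : Set X) := fun n => (f n).2.1
  have hfv : ∀ n, ∃ v, S.IsCylinder v (f n : Set X) ∧ ‖v‖ ≤ M := fun n => (f n).2.2
  choose v hv hvM using hfv
  have hstrip : ∀ n, ∃ I Φ, S.IsStripMap (v n) (f n : Set X) I Φ := fun n =>
    (hv n).prop.exists_isStripMap
  choose I Φ hΦ using hstrip
  set η : ℕ → ℝ := fun n => a / (4 * ‖v n‖ ^ 2)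
  have hv0 : ∀ n, 0 < ‖v n‖ := fun n => norm_pos_iff.2 (hΦ n).ne_zero
  have hη : ∀ n, 0 < η n := fun n => by have := hv0 n; positivity
  have hpos : 0 < S.area {x | ∃ᶠ n in atTop, x ∈ Φ n '' stripCore (I n) (η n)} :=
    (ENNReal.ofReal_pos.2 (half_pos ha)).trans_le (le_measure_frequently_mem
      (fun n => ((hΦ n).isOpen_image_stripCore (hη n).le).measurableSet)
      fun n => (hΦ n).ofReal_le_area_core ha (hfa n))
  obtain ⟨p, hp⟩ := nonempty_of_measure_ne_zero hpos.ne'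
  obtain ⟨φ, hφ, hpφ⟩ := extraction_of_frequently_atTop hp
  have hpf : ∀ n, p ∈ (f (φ n) : Set X) := by
    intro n
    obtain ⟨u, hu, hup⟩ := hpφ n
    have := im_add_mem_of_mem_stripCore (hΦ (φ n)).ordConnected hu (x := 0)
      (by simpa using (hη (φ n)).le)
    rw [← (hΦ (φ n)).image_eq]
    exact ⟨u, by simpa using this, hup⟩
  obtain ⟨z, -, ψ, hψ, hlim⟩ := tendsto_subseq_of_bounded (x := fun n => v (φ n))
    (Metric.isBounded_closedBall (x := (0 : ℂ)) (r := M)) fun n => by simpa using hvM (φ n)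
  -- a disc around `p` in which `p` has no other preimage
  obtain ⟨γ, hγ, hγ0, -⟩ := (hv (φ 0)).prop.2.2 p (hpf 0)
  obtain ⟨e, he, hpe, -⟩ := hγ.2.1 0
  rw [hγ0] at hpe
  obtain ⟨ε₀, hε₀, Ψ, hΨ0, hΨ⟩ := exists_hasFlatBall (S := S) 1 (C := Set.univ) univ_mem he hpe
  obtain ⟨ε₁, hε₁, hΨ₁⟩ := Metric.eventually_nhds_iff_ball.1
    ((hΨ 0 (Metric.mem_ball_self hε₀)).1.eventually_ne one_ne_zero)
  have hM : 0 < M := (hv0 0).trans_le (hvM 0)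
  set ε := min (min ε₀ ε₁) (a / (4 * M))
  have hε : 0 < ε := lt_min (lt_min hε₀ hε₁) (by positivity)
  obtain ⟨N, hN⟩ := Metric.cauchySeq_iff'.1 hlim.cauchySeq ε hε
  have hclose := hN (N + 1) (Nat.le_succ N)
  rw [dist_eq_norm] at hclose
  simp only [Function.comp] at hclose
  set n := φ (ψ N)
  set m := φ (ψ (N + 1))
  have hnm : n ≠ m := fun h => by
    have := hψ.injective (hφ.injective h)
    omega
  have hvv : v m = v n := by
    refine (hΦ n).development_eq (hv m).prop (hpφ (ψ N)) (hpf (ψ (N + 1))) hΨ0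
      (ε := min ε₀ ε₁) (fun u hu => ⟨(hΨ u (Metric.ball_subset_ball (min_le_left _ _) hu)).1, ?_⟩) ?_
      (hclose.trans_le (min_le_left _ _))
    · rw [← hΨ0]
      exact hΨ₁ u (Metric.ball_subset_ball (min_le_right _ _) hu)
    · refine hclose.trans_le ((min_le_right _ _).trans ?_)
      have h1 := hv0 n
      calc a / (4 * M) ≤ a / (4 * ‖v n‖) := by gcongr; exact hvM n
        _ = η n * ‖v n‖ := by simp only [η]; field_simp
  have hC : (f m : Set X) = f n :=
    (hvv ▸ hv m).eq_of_inter (hv n) ⟨p, hpf _, hpf _⟩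
  exact hnm (f.injective (Subtype.ext hC)).symm

theorem CylApproximable.exists_large {a θ w : ℝ} (ha : 0 < a) (hw : 0 ≤ w)
    (h : S.CylApproximable a θ w) (M : ℝ) :
    ∃ v C, S.IsCylinder v C ∧ ENNReal.ofReal a ≤ S.area C ∧ 1 ≤ |imComp v θ| ∧
      M ≤ |imComp v θ| ∧ |reComp v θ| < 1 / |imComp v θ| ^ w := by
  by_contra! hcon
  refine h ((S.finite_setOf_isCylinder ha (1 + M)).subset ?_)
  rintro C ⟨hC, v, hv, hv1, hvw⟩
  refine ⟨hC, v, hv, ?_⟩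
  have hM : |imComp v θ| < M := by
    by_contra! hle
    exact absurd hvw (not_lt.2 (hcon v C hv hC hv1 hle))
  have hre : |reComp v θ| < 1 := hvw.trans_le <| by
    rw [div_le_one (by positivity)]
    exact Real.one_le_rpow hv1 hw
  refine le_of_sq_le_sq ?_ (by linarith)
  rw [← reComp_sq_add_imComp_sq v θ, ← sq_abs (reComp v θ), ← sq_abs (imComp v θ)]
  nlinarith [abs_nonneg (reComp v θ), abs_nonneg (imComp v θ)]

end Cylinders

/-! ### Cylinders that approximate the direction of the flow -/

section Main

variable [MeasurableSpace X] [BorelSpace X] [CompactSpace X] [T2Space X]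
  {S : TranslationSurface X}

/-- If infinitely many cylinders approximate `θ` at the rate `w`, the limsup hitting exponent is
almost everywhere at least any `c < w`. -/
theorem CylApproximable.ae_le_limsupHitting {θ : ℝ} (hθ : S.IsErgodicDirection θ) {a w c : ℝ}
    (ha : 0 < a) (h : S.CylApproximable a θ w) (hc0 : 0 ≤ c) (hcw : c < w) :
    ∀ᵐ q ∂(S.area.prod S.area), (c : EReal) ≤ S.limsupHitting θ q.1 q.2 := by
  have := S.isFiniteMeasure_area
  have hw : 0 < w := hc0.trans_lt hcw
  set δ : ℕ → ℝ := fun n => (1 / 2) ^ n * (a / 8) with hδdef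
  have hδ : ∀ n, 0 < δ n := fun n => by positivity
  -- the circumferences are so large that `(2 * m / δ n) ^ c ≤ δ n * m ^ w`
  set M : ℕ → ℝ := fun n => max (n : ℝ) ((2 ^ c / (δ n ^ c * δ n)) ^ (1 / (w - c)))
  have hseq := fun n => h.exists_large ha hw.le (M n)
  choose v C hC hCa hv1 hvM hvw using hseq
  have hstrip : ∀ n, ∃ I Φ, S.IsStripMap (v n) (C n) I Φ := fun n => (hC n).prop.exists_isStripMap
  choose I Φ hΦ using hstrip
  have hv0 : ∀ n, 0 < ‖v n‖ := fun n => norm_pos_iff.2 (hΦ n).ne_zero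
  set η : ℕ → ℝ := fun n => a / (4 * ‖v n‖ ^ 2) with hηdef
  have hη : ∀ n, 0 < η n := fun n => by have := hv0 n; positivity
  have hηv : ∀ n, η n * ‖v n‖ ^ 2 = a / 4 := fun n => by
    have := hv0 n
    simp only [η]; field_simp
  set E : ℕ → ℕ → Set X := fun k n => Φ n '' stripCore (I n) ((1 / 2) ^ k * η n)
  have hEo : ∀ k n, IsOpen (E k n) := fun k n =>
    (hΦ n).isOpen_image_stripCore (by have := hη n; positivity)
  have hEmono : ∀ k n, k ≤ n → E k n ⊆ E n n := by
    rintro k n hkn _ ⟨u, hu, rfl⟩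
    refine ⟨u, ?_, rfl⟩
    have h1 : (1 / 2 : ℝ) ^ n * η n ≤ (1 / 2) ^ k * η n := by
      have := (hη n).le
      gcongr ?_ * _
      exact pow_le_pow_of_le_one (by norm_num) (by norm_num) hkn
    have := add_mem_stripCore (hΦ n).ordConnected hu (x := 0) (η' := (1 / 2) ^ n * η n)
      (by have := hη n; positivity) (by simpa using h1)
    simpa using this
  have hre : Tendsto (fun n => |reComp (v n) θ|) atTop (𝓝 0) := by
    have hm : Tendsto (fun n => |imComp (v n) θ|) atTop atTop :=
      tendsto_atTop_mono (fun n => (le_max_left _ _).trans (hvM n)) tendsto_natCast_atTop_atTop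
    have hmw := ((tendsto_rpow_atTop hw).comp hm).inv_tendsto_atTop
    refine squeeze_zero (fun n => abs_nonneg _) (fun n => (hvw n).le) ?_
    simp only [one_div]
    exact hmw
  -- the points that lie deep in infinitely many cylinders form an invariant set
  set A : Set X := ⋃ k, {p | ∃ᶠ n in atTop, p ∈ E k n}
  have hA : MeasurableSet A := MeasurableSet.iUnion fun k =>
    measurableSet_frequently_mem fun n => (hEo k n).measurableSet
  have hAinv : ∀ t, ∀ p ∈ A, S.flow θ t p ∈ A := by
    intro t p hp
    obtain ⟨k, hk⟩ := Set.mem_iUnion.1 hp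
    refine Set.mem_iUnion.2 ⟨k + 1, ?_⟩
    have hev : ∀ᶠ n in atTop, |t| * |reComp (v n) θ| < (1 / 2) ^ k * (a / 8) := by
      have := hre.const_mul |t|
      rw [mul_zero] at this
      exact this.eventually_lt_const (by positivity)
    refine (Frequently.and_eventually hk hev).mono ?_
    rintro n ⟨hpn, hn⟩
    have h2 := (hΦ n).flow_mem_image_stripCore (by have := hη n; positivity) hpn (θ := θ) (t := t) ?_
    · have : (1 / 2 : ℝ) ^ k * η n / 2 = (1 / 2) ^ (k + 1) * η n := by rw [pow_succ]; ring
      rwa [this] at h2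
    · refine hn.le.trans (le_of_eq ?_)
      linear_combination (-(1 / 2 : ℝ) ^ k / 2) * hηv n
  have hApos : S.area A ≠ 0 := by
    refine (((ENNReal.ofReal_pos.2 (half_pos ha)).trans_le (le_measure_frequently_mem
      (fun n => (hEo 0 n).measurableSet) fun n => ?_)).trans_le
        (measure_mono (Set.subset_iUnion (fun k => {p | ∃ᶠ n in atTop, p ∈ E k n}) 0))).ne'
    simpa [E] using (hΦ n).ofReal_le_area_core ha (hCa n)
  have hAc : S.area Aᶜ = 0 :=
    (hθ A hA fun t => preimage_flow_eq hAinv t).resolve_left hApos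
  have haeA : ∀ᵐ q ∂(S.area.prod S.area), q.1 ∈ A :=
    Measure.quasiMeasurePreserving_fst.ae (measure_eq_zero_iff_ae_notMem.1 hAc |>.mono
      fun p hp => not_not.1 hp)
  have haeN : ∀ᵐ q ∂(S.area.prod S.area), ∀ᶠ n in atTop,
      q ∉ nearPairs (I n) (Φ n) ((1 / 2) ^ n * η n) := by
    refine S.ae_prod_eventually_notMem (fun n => (hΦ n).isOpen_nearPairs _)
      (f := fun n => 4 * δ n) ?_ fun n p => ?_
    · exact ((summable_geometric_of_lt_one (by norm_num) (by norm_num)).mul_right _).mul_left _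
    · refine ((hΦ n).area_nearPairs_section_le _ p).trans (ENNReal.ofReal_le_ofReal (le_of_eq ?_))
      simp only [hδdef]
      linear_combination (2 * (1 / 2 : ℝ) ^ n) * hηv n
  have hvm : ∀ n, |imComp (v n) θ| ≤ ‖v n‖ ∧ ‖v n‖ ≤ 2 * |imComp (v n) θ| := by
    intro n
    have hre1 : |reComp (v n) θ| < 1 := (hvw n).trans_le <| by
      have := hv1 n
      rw [div_le_one (by positivity)]
      exact Real.one_le_rpow (hv1 n) hw.le
    have h1 := reComp_sq_add_imComp_sq (v n) θ
    rw [← sq_abs (reComp _ _), ← sq_abs (imComp _ _)] at h1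
    have := hv1 n
    constructor <;> refine le_of_sq_le_sq ?_ (by positivity) <;>
      nlinarith [abs_nonneg (reComp (v n) θ)]
  set r : ℕ → ℝ := fun n => δ n / ‖v n‖
  have hr0 : ∀ n, 0 < r n := fun n => div_pos (hδ n) (hv0 n)
  have hrlim : Tendsto r atTop (𝓝[>] 0) := by
    have hδlim : Tendsto δ atTop (𝓝 0) := by
      simpa [hδdef] using (tendsto_pow_atTop_nhds_zero_of_lt_one (r := (1 / 2 : ℝ))
        (by norm_num) (by norm_num)).mul_const (a / 8)
    exact tendsto_nhdsWithin_iff.2 ⟨squeeze_zero (fun n => (hr0 n).le)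
      (fun n => div_le_self (hδ n).le ((hv1 n).trans (hvm n).1)) hδlim, Eventually.of_forall hr0⟩
  have hrate : ∀ n, r n ^ (-c) ≤ δ n * |imComp (v n) θ| ^ w := by
    intro n
    set m := |imComp (v n) θ|
    have hm : 0 < m := one_pos.trans_le (hv1 n)
    have hδn := hδ n
    have h1 : 2 ^ c / (δ n ^ c * δ n) ≤ m ^ (w - c) := by
      have h2 := Real.rpow_le_rpow (by positivity) ((le_max_right _ _).trans (hvM n))
        (sub_nonneg.2 hcw.le)
      rwa [← Real.rpow_mul (by positivity), one_div, inv_mul_cancel₀ (sub_pos.2 hcw).ne',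
        Real.rpow_one] at h2
    rw [div_le_iff₀ (by positivity), Real.rpow_sub hm] at h1
    calc r n ^ (-c) = (‖v n‖ / δ n) ^ c := by
          rw [Real.rpow_neg (hr0 n).le, ← Real.inv_rpow (hr0 n).le]
          simp only [r, inv_div]
      _ ≤ (2 * m / δ n) ^ c := by
        gcongr
        exact (hvm n).2
      _ = 2 ^ c * m ^ c / δ n ^ c := by
        rw [Real.div_rpow (by positivity) hδn.le, Real.mul_rpow (by norm_num) hm.le]
      _ ≤ (m ^ w / m ^ c * (δ n ^ c * δ n)) * m ^ c / δ n ^ c := by gcongr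
      _ = δ n * m ^ w := by
        field_simp
  filter_upwards [haeA, haeN] with q hqA hqN
  obtain ⟨k, hk⟩ := Set.mem_iUnion.1 hqA
  refine le_limsupHitting (hrlim.frequently ?_)
  refine ((Frequently.and_eventually hk (hqN.and (eventually_ge_atTop k)))).mono ?_
  rintro n ⟨hqk, hqn, hkn⟩
  refine (ENNReal.ofReal_le_ofReal (hrate n)).trans (le_hittingTime fun t hrt hdist => ?_)
  have ht0 : 0 < t := (hr0 n).trans hrt
  have hdrift : δ n ≤ t * |reComp (v n) θ| := by
    by_contra! hlt
    refine hqn ((hΦ n).mem_nearPairs_of_flatDist_lt (hEmono k n hkn hqk) (θ := θ) (t := t) ?_ ?_)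
    · rw [abs_of_pos ht0]
      refine hlt.trans_le (le_of_eq ?_)
      simp only [hδdef]
      linear_combination (-(1 / 2 : ℝ) ^ n / 2) * hηv n
    · convert hdist using 2
      have hvn := (hv0 n).ne'
      simp only [hδdef, hηdef, r]
      field_simp
      ring
  have hmw : 0 < |imComp (v n) θ| ^ w := Real.rpow_pos_of_pos (one_pos.trans_le (hv1 n)) w
  have h2 : δ n ≤ t / |imComp (v n) θ| ^ w := by
    refine hdrift.trans ?_
    rw [div_eq_mul_one_div]
    exact mul_le_mul_of_nonneg_left (hvw n).le ht0.le
  rwa [le_div_iff₀ hmw] at h2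

end Main

end TranslationSurface

theorem proposition4p5 {X : Type*} [TopologicalSpace X] [CompactSpace X] [T2Space X]
    [ConnectedSpace X] [MeasurableSpace X] [BorelSpace X] (S : TranslationSurface X)
    (θ : ℝ) (hθ : S.IsErgodicDirection θ) (a : ℝ) (ha : 0 < a) :
    ∀ᵐ q ∂(S.area.prod S.area), S.wCyl a θ ≤ S.limsupHitting θ q.1 q.2 := by
  have hrat : ∀ c : ℚ, ∀ᵐ q ∂(S.area.prod S.area),
      ((c : ℝ) : EReal) < S.wCyl a θ → ((c : ℝ) : EReal) ≤ S.limsupHitting θ q.1 q.2 := by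
    intro c
    rcases lt_or_ge (c : ℝ) 1 with hc | hc
    · filter_upwards [S.ae_le_limsupHitting_of_lt_one θ hc] with q hq _ using hq
    · by_cases hcw : ((c : ℝ) : EReal) < S.wCyl a θ
      · rw [TranslationSurface.wCyl, lt_max_iff, lt_iSup_iff] at hcw
        rcases hcw with h1 | ⟨w, hw⟩
        · exact absurd (by exact_mod_cast h1) (not_lt.2 hc)
        · rw [lt_iSup_iff] at hw
          obtain ⟨⟨-, hwa⟩, hcw⟩ := hw
          filter_upwards [hwa.ae_le_limsupHitting hθ ha (zero_le_one.trans hc)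
            (by exact_mod_cast hcw)] with q hq _ using hq
      · exact Filter.Eventually.of_forall fun q h => absurd h hcw
  filter_upwards [ae_all_iff.2 hrat] with q hq
  refine le_of_forall_lt fun x hx => ?_
  obtain ⟨c, hxc, hcw⟩ := EReal.exists_rat_btwn_of_lt hx
  exact hxc.trans_le (hq c hcw)
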